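/- **Setting.** Minkowski space is $\mathbb R\times\mathbb R^3$ (so $s=3$), with points $x=(x_0,\vec x)$. Let $\mathcal O\mapsto\mathcal A(\mathcal O)$, $\mathcal O$ ranging over the bounded contractible open regions, be an isotone net of unital $C^*$-algebras with common unit, $\mathcal A_L=\bigcup_{\mathcal O}\mathcal A(\mathcal O)$ its strictly local algebra and $\mathcal A=\overline{\mathcal A_L}$. Algebras of totally space-like regions commute, and the space-time translations act covariantly by automorphisms $\alpha_a$ of $\mathcal A$, $\alpha_a(\mathcal A(\mathcal O))=\mathcal A(\mathcal O+a)$, with time translations $\tau_t=\alpha_{(t,0)}$ norm continuous in $t$; write $\sigma_{\vec x}=\alpha_{(0,\vec x)}$. *Particle content.* Let $\omega_0$ be a vacuum state of the theory: a translation invariant state on $\mathcal A$ whose GNS representation carries a strongly continuous unitary implementation of the translations with spectrum in the closed forward cone and with the GNS vector as its unique (up to a factor) invariant vector. The theory *has particles of mass $m\ge 0$* if the mass operator $(P_0^2-\vec P^{\,2})^{1/2}$ has the eigenvalue $m$ on the orthogonal complement of the vacuum vector. The theory is *massless* if it has particles of mass $0$, and *massive* if only masses $m>0$ occur. *Thermal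 state.* Let $\omega$ be a translation invariant factor state on $\mathcal A$ that satisfies the KMS condition for $\tau$ at some $\beta>0$, with GNS representation $(\mathcal H,\pi,\Omega)$ in which the translations are implemented by a strongly continuous unitary group $T(a)$ with $T(a)\Omega=\Omega$. Say that $\omega$ *clusters with rate $\delta$* if for all $A,B\in\mathcal A_L$ $$\omega(A\,\sigma_{\vec x}(B))-\omega(A)\,\omega(B)=O(|\vec x|^{-\delta})\qquad(|\vec x|\to\infty).$$ *Conserved current.* For $\mu=0,\dots,3$ and real $f\in C_0^\infty(\mathbb R^4)$ let $J_\mu(f)$ be self-adjoint operators on $\mathcal H$ such that: $\Omega\in D(J_\mu(f))$, and $f\mapsto J_\mu(f)\Omega$ is linear and continuous; $T(a)J_\mu(f)T(a)^{-1}=J_\mu(f(\cdot-a))$; $\sum_\mu J_\mu(\partial f/\partial x_\mu)=0$ on the common domain; $(\Omega,[J_\mu(f),A]\Omega):=(J_\mu(f)\Omega,A\Omega)-(A^*\Omega,J_\mu(f)\Omega)$ vanishes for $A\in\mathcal A(\mathcal O)$ with $\mathcal O$ totally space-like to $\operatorname{supp}f$; $(J_0(f)\Omega,J_i(g)\Omega)=(J_i(g)\Omega,J_0(f)\Omega)$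 for $i=1,2,3$ if $\operatorname{supp}f$ and $\operatorname{supp}g$ are totally space-like to one another; $J_0(f)$ is affiliated with $\pi(\mathcal A(\mathcal O))''$ if $\operatorname{supp}f\subset\mathcal O$. *Symmetry and its breaking.* Cutoffs are $f\in C_0^\infty(\mathbb R)$ with $\int f=1$ and $g\in C_0^\infty(\mathbb R^3)$ with $g=1$ for $|\vec x|\le 1$ and $g=0$ for $|\vec x|>1+r$, some $0<r<1$; put $(f\otimes g_R)(x)=f(x_0)\,g(\vec x/R)$. Let $A\mapsto A^\lambda$ be a strongly continuous one-parameter group of automorphisms of $\mathcal A$ that maps $\mathcal A(\{|\vec x|+|x_0|<L\})$ into itself for every $L>0$ and is generated by the current: for all $A\in\mathcal A_L$ and all cutoffs, $$\frac{d}{d\lambda}\omega(A^\lambda)\Big|_{\lambda=0}=i\lim_{R\to\infty}(\Omega,[J_0(f\otimes g_R),A]\Omega).$$ The symmetry is *spontaneously broken* if for some $A_0\in\mathcal A_L$ and some cutoffs $\lim_{R\to\infty}(\Omega,[J_0(f\otimes g_R),A_0]\Omega)=c\neq 0$. **Corollary.** Assume that the following conjectured relation between mass and space-like decay holds for the theory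 and its thermal state $\omega$: 1. if the theory is massless, then $\omega$ clusters with some rate $0<\delta\le 1$, and with no rate $\delta>1$; 2. if the theory is massive, then $\omega$ clusters with some rate $\delta>1$. If the symmetry is spontaneously broken in $\omega$, then the theory has particles of mass zero. -/

import Mathlib

open Filter Topology MeasureTheory TopologicalSpace
open scoped ComplexOrder Distributions

noncomputable section

namespace ThermalQFT

/-! ### Minkowski space and test functions -/

/-- Physical space `ℝ³` with the Euclidean norm. -/
abbrev Space : Type := EuclideanSpace ℝ (Fin 3)

/-- Minkowski space; a point is `x = (x₀, x⃗)`. -/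
abbrev Spacetime : Type := ℝ × Space

/-- Real test functions `C₀^∞(ℝ⁴)`. -/
abbrev TestFn : Type := 𝓓((⊤ : Opens Spacetime), ℝ)

/-- The coordinate directions; index `0` is time. -/
def dir : Fin 4 → Spacetime :=
  Fin.cons (1, 0) (fun i : Fin 3 => (0, EuclideanSpace.single i 1))

/-- The partial derivative `∂f/∂x_μ` of a test function. -/
def pderiv (μ : Fin 4) (f : TestFn) : TestFn :=
  LineDeriv.lineDerivOp (dir μ) f

/-- The wave operator `□ = ∂₀² - ∂₁² - ∂₂² - ∂₃²`. -/
def box (f : TestFn) : TestFn :=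
  pderiv 0 (pderiv 0 f) - ∑ i : Fin 3, pderiv i.succ (pderiv i.succ f)

/-- The translate `f_a(x) = f(x - a)`. -/
def translate (a : Spacetime) (f : TestFn) : TestFn where
  toFun x := f (x - a)
  contDiff' := f.contDiff.comp (contDiff_id.sub contDiff_const)
  hasCompactSupport' := f.hasCompactSupport.comp_homeomorph (Homeomorph.subRight a)
  tsupport_subset' := fun _ _ => trivial

theorem smear_hasCompactSupport (f : 𝓓((⊤ : Opens ℝ), ℝ)) (g : 𝓓((⊤ : Opens Space), ℝ))
    {R : ℝ} (hR : 0 < R) :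
    HasCompactSupport (fun x : Spacetime => f x.1 * g (R⁻¹ • x.2)) := by
  have hg : HasCompactSupport (fun y : Space => g (R⁻¹ • y)) :=
    g.hasCompactSupport.comp_homeomorph (Homeomorph.smulOfNeZero R⁻¹ (inv_ne_zero hR.ne'))
  refine HasCompactSupport.of_support_subset_isCompact
    (f.hasCompactSupport.isCompact.prod hg.isCompact) ?_
  intro x hx
  rw [Function.mem_support] at hx
  exact ⟨subset_tsupport _ (left_ne_zero_of_mul hx), subset_tsupport _ (right_ne_zero_of_mul hx)⟩

/-- The test function `(f ⊗ g_R)(x) = f(x₀) g(x⃗ / R)` for `R > 0`. Only `R → ∞` matters; the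
value for `R ≤ 0` is `0` by convention. -/
def smear (f : 𝓓((⊤ : Opens ℝ), ℝ)) (g : 𝓓((⊤ : Opens Space), ℝ)) (R : ℝ) : TestFn :=
  open Classical in
  if hR : 0 < R then
    { toFun := fun x => f x.1 * g (R⁻¹ • x.2)
      contDiff' := (f.contDiff.comp contDiff_fst).mul
        (g.contDiff.comp (contDiff_snd.const_smul R⁻¹))
      hasCompactSupport' := smear_hasCompactSupport f g hR
      tsupport_subset' := fun _ _ => trivial }
  else 0

/-- `∫ f = 1` and `f` vanishes for `|x₀| ≥ d`, for some `d > 0`. -/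
def IsTimeCutoff (f : 𝓓((⊤ : Opens ℝ), ℝ)) : Prop :=
  (∫ t, f t) = 1 ∧ ∃ d > 0, ∀ t, d ≤ |t| → f t = 0

/-- `g = 1` on the unit ball and `g = 0` outside the ball of radius `1 + r`, for some
`0 < r < 1`. -/
def IsSpaceCutoff (g : 𝓓((⊤ : Opens Space), ℝ)) : Prop :=
  (∀ x, ‖x‖ ≤ 1 → g x = 1) ∧ ∃ r, 0 < r ∧ r < 1 ∧ ∀ x, 1 + r < ‖x‖ → g x = 0

/-- Two sets are totally space-like to one another. -/
def Spacelike (S S' : Set Spacetime) : Prop :=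
  ∀ x ∈ S, ∀ y ∈ S', |x.1 - y.1| < ‖x.2 - y.2‖

/-- A finite (bounded), contractible, open region of Minkowski space. -/
structure Region where
  carrier : Set Spacetime
  isOpen : IsOpen carrier
  isBounded : Bornology.IsBounded carrier
  contractible : ContractibleSpace carrier

/-! ### Nets of local algebras, states and their representations -/

/-- A net of local C⋆-algebras with common unit, with total algebra `A`, local commutativity,
and space-time translation automorphisms that are norm continuous in time. -/
structure LocalNet (A : Type*) [CStarAlgebra A] where
  alg : Region → StarSubalgebra ℂ A
  isClosed : ∀ O, IsClosed (alg O : Set A)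
  isotone : ∀ O O' : Region, O.carrier ⊆ O'.carrier → alg O ≤ alg O'
  dense : Dense (⋃ O, (alg O : Set A))
  local_comm : ∀ O O' : Region, Spacelike O.carrier O'.carrier →
    ∀ a ∈ alg O, ∀ b ∈ alg O', a * b = b * a
  /-- The automorphism `α_x` of translation by `x`; time translations are `τ_t = α_(t,0)` and
  space translations are `σ_y = α_(0,y)`. -/
  trans : Spacetime → (A ≃⋆ₐ[ℂ] A)
  trans_add : ∀ x y a, trans (x + y) a = trans x (trans y a)
  covariant : ∀ (x : Spacetime) (O O' : Region), O'.carrier = (fun y => y + x) '' O.carrier →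
    ∀ a ∈ alg O, trans x a ∈ alg O'
  time_continuous : ∀ a, Continuous fun t : ℝ => trans (t, 0) a

section Net

variable {A : Type*} [CStarAlgebra A]

/-- The strictly local algebra `A_L`, the union of the local algebras. -/
def LocalNet.strictlyLocal (N : LocalNet A) : Set A := ⋃ O, (N.alg O : Set A)

variable [PartialOrder A] [StarOrderedRing A]

/-- The data of the GNS representation of a translation invariant state `ω`: a representation
`π` on `H` with cyclic vector `Ω` inducing `ω`, and the strongly continuous unitary group
`T` of space-time translations that it implements. It is unique up to unitary equivalence. -/
structure InvariantRep (N : LocalNet A) (ω : A →ₚ[ℂ] ℂ) (H : Type*) [NormedAddCommGroup H]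
    [InnerProductSpace ℂ H] [CompleteSpace H] where
  normalized : ω 1 = 1
  invariant : ∀ x a, ω (N.trans x a) = ω a
  π : A →⋆ₐ[ℂ] (H →L[ℂ] H)
  Ω : H
  cyclic : Dense (Set.range fun a => π a Ω)
  inner_eq : ∀ a, inner ℂ Ω (π a Ω) = ω a
  T : Spacetime → (H ≃ₗᵢ[ℂ] H)
  T_apply : ∀ x a, T x (π a Ω) = π (N.trans x a) Ω
  T_continuous : ∀ ξ, Continuous fun x => T x ξ

/-- The KMS condition at inverse temperature `β`. -/
def IsKMS (N : LocalNet A) (ω : A →ₚ[ℂ] ℂ) (β : ℝ) : Prop :=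
  ∀ a b : A, ∃ F : ℂ → ℂ,
    ContinuousOn F {z | 0 ≤ z.im ∧ z.im ≤ β} ∧
    DifferentiableOn ℂ F {z | 0 < z.im ∧ z.im < β} ∧
    (∃ C : ℝ, ∀ z : ℂ, 0 < z.im → z.im < β → ‖F z‖ ≤ C) ∧
    (∀ t : ℝ, F t = ω (a * N.trans (t, 0) b)) ∧
    (∀ t : ℝ, F (t + Complex.I * β) = ω (N.trans (t, 0) b * a))

/-- The truncated correlation functions of strictly local observables are `O(|x⃗|^{-δ})`. -/
def ClustersWithRate (N : LocalNet A) (ω : A →ₚ[ℂ] ℂ) (δ : ℝ) : Prop :=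
  ∀ a ∈ N.strictlyLocal, ∀ b ∈ N.strictlyLocal,
    (fun x : Space => ω (a * N.trans (0, x) b) - ω a * ω b)
      =O[Bornology.cobounded Space] fun x => ‖x‖ ^ (-δ)

variable {H : Type*} [NormedAddCommGroup H] [InnerProductSpace ℂ H] [CompleteSpace H]

/-- The von Neumann algebra `R(O)` in the given representation, i.e. the weak closure (double
commutant) of the represented local algebra. -/
def InvariantRep.localVN {N : LocalNet A} {ω : A →ₚ[ℂ] ℂ} (r : InvariantRep N ω H)
    (O : Region) : Set (H →L[ℂ] H) :=
  Set.centralizer (Set.centralizer (r.π '' (N.alg O : Set A)))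

/-- The closed operator `S` is affiliated with `M`: `M' D(S) ⊆ D(S)` and `S b = b S` on `D(S)`
for every `b` in the commutant `M'`. -/
def Affiliated (S : H →ₗ.[ℂ] H) (M : Set (H →L[ℂ] H)) : Prop :=
  S.IsClosed ∧ ∀ b ∈ Set.centralizer M, ∀ ξ : S.domain,
    ∃ h : b (ξ : H) ∈ S.domain, S ⟨b (ξ : H), h⟩ = b (S ξ)

/-- A thermal equilibrium state: a translation invariant factor state satisfying the KMS
condition at inverse temperature `β > 0`. -/
structure ThermalRep (N : LocalNet A) (ω : A →ₚ[ℂ] ℂ) (β : ℝ) (H : Type*)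
    [NormedAddCommGroup H] [InnerProductSpace ℂ H] [CompleteSpace H]
    extends InvariantRep N ω H where
  β_pos : 0 < β
  factor : ∀ b ∈ Set.centralizer (Set.centralizer (Set.range π)),
    b ∈ Set.centralizer (Set.range π) → ∃ z : ℂ, b = z • (1 : H →L[ℂ] H)
  kms : IsKMS N ω β

/-! ### Conserved currents, symmetries and their spontaneous breakdown -/

/-- A conserved local current `J_μ` in the representation of `ω`. -/
structure ConservedCurrent {N : LocalNet A} {ω : A →ₚ[ℂ] ℂ} (r : InvariantRep N ω H) where
  J : Fin 4 → TestFn → (H →ₗ.[ℂ] H)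
  selfAdjoint : ∀ μ f, IsSelfAdjoint (J μ f)
  mem_domain : ∀ μ f, r.Ω ∈ (J μ f).domain
  /-- `J_μ` is a field, i.e. a distribution: `f ↦ J_μ(f) Ω` is linear and continuous. -/
  linear : ∀ μ, IsLinearMap ℝ fun f => J μ f ⟨r.Ω, mem_domain μ f⟩
  continuous : ∀ μ, Continuous fun f => J μ f ⟨r.Ω, mem_domain μ f⟩
  covariant : ∀ μ f x (ξ : (J μ f).domain),
    ∃ h : r.T x (ξ : H) ∈ (J μ (translate x f)).domain,
      J μ (translate x f) ⟨r.T x (ξ : H), h⟩ = r.T x (J μ f ξ)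
  conserved : ∀ f ξ (h : ∀ μ, ξ ∈ (J μ (pderiv μ f)).domain),
    ∑ μ, J μ (pderiv μ f) ⟨ξ, h μ⟩ = 0
  local_observables : ∀ μ (f : TestFn) (O : Region), Spacelike (tsupport f) O.carrier → ∀ a ∈ N.alg O,
    inner ℂ (J μ f ⟨r.Ω, mem_domain μ f⟩) (r.π a r.Ω)
      - inner ℂ (r.π (star a) r.Ω) (J μ f ⟨r.Ω, mem_domain μ f⟩) = 0
  local_currents : ∀ (i : Fin 3) (f g : TestFn), Spacelike (tsupport f) (tsupport g) →
    inner ℂ (J 0 f ⟨r.Ω, mem_domain 0 f⟩) (J i.succ g ⟨r.Ω, mem_domain i.succ g⟩)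
      - inner ℂ (J i.succ g ⟨r.Ω, mem_domain i.succ g⟩) (J 0 f ⟨r.Ω, mem_domain 0 f⟩) = 0
  affiliated : ∀ (f : TestFn) (O : Region), tsupport f ⊆ O.carrier → Affiliated (J 0 f) (r.localVN O)

/-- `(Ω, [J₀(f), a] Ω) := (J₀(f)Ω, aΩ) - (a⋆Ω, J₀(f)Ω)`. -/
def ConservedCurrent.chargeComm {N : LocalNet A} {ω : A →ₚ[ℂ] ℂ} {r : InvariantRep N ω H}
    (j : ConservedCurrent r) (f : TestFn) (a : A) : ℂ :=
  inner ℂ (j.J 0 f ⟨r.Ω, j.mem_domain 0 f⟩) (r.π a r.Ω)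
    - inner ℂ (r.π (star a) r.Ω) (j.J 0 f ⟨r.Ω, j.mem_domain 0 f⟩)

/-- A continuous internal symmetry generated by the current `j`: a strongly continuous
one-parameter group of automorphisms that leaves the algebras of the double cones
`|x⃗| + |x₀| < L` invariant and is generated, in the state, by the charge of `j`. -/
structure InternalSymmetry {N : LocalNet A} {ω : A →ₚ[ℂ] ℂ} {r : InvariantRep N ω H}
    (j : ConservedCurrent r) where
  γ : ℝ → (A ≃⋆ₐ[ℂ] A)
  γ_add : ∀ s t a, γ (s + t) a = γ s (γ t a)
  γ_continuous : ∀ a, Continuous fun s => γ s a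
  preserves : ∀ L > 0, ∀ O : Region, O.carrier = {x | ‖x.2‖ + |x.1| < L} →
    ∀ s, ∀ a ∈ N.alg O, γ s a ∈ N.alg O
  generated : ∀ a ∈ N.strictlyLocal, ∀ f g, IsTimeCutoff f → IsSpaceCutoff g →
    ∃ c : ℂ, Tendsto (fun R => j.chargeComm (smear f g R) a) atTop (𝓝 c) ∧
      HasDerivAt (fun s => ω (γ s a)) (Complex.I * c) 0

/-- Spontaneous breakdown of the symmetry: `lim_{R → ∞} (Ω, [J₀(f ⊗ g_R), a] Ω) = c ≠ 0` for
some strictly local `a`. -/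
def InternalSymmetry.SpontaneouslyBroken {N : LocalNet A} {ω : A →ₚ[ℂ] ℂ}
    {r : InvariantRep N ω H} {j : ConservedCurrent r} (_ : InternalSymmetry j) : Prop :=
  ∃ a ∈ N.strictlyLocal, ∃ f g, IsTimeCutoff f ∧ IsSpaceCutoff g ∧
    ∃ c : ℂ, c ≠ 0 ∧ Tendsto (fun R => j.chargeComm (smear f g R) a) atTop (𝓝 c)

/-! ### The particle content of the theory -/

/-- The vacuum representation of the theory: translation invariant state with unique invariant
vector, whose energy-momentum spectrum lies in the closed forward cone. The latter is expressed
by positivity of the generator of `t ↦ T(t e)` for each future directed time-like `e`, i.e. by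
bounded analytic continuation of `t ↦ (ξ, T(t e) η)` to the upper half plane. -/
structure VacuumRep (N : LocalNet A) (ω₀ : A →ₚ[ℂ] ℂ) (H : Type*)
    [NormedAddCommGroup H] [InnerProductSpace ℂ H] [CompleteSpace H]
    extends InvariantRep N ω₀ H where
  unique : ∀ ξ : H, (∀ x, T x ξ = ξ) → ∃ z : ℂ, ξ = z • Ω
  spectrum : ∀ e : Spacetime, ‖e.2‖ < e.1 → ∀ ξ η : H, ∃ F : ℂ → ℂ,
    ContinuousOn F {z | 0 ≤ z.im} ∧
    DifferentiableOn ℂ F {z | 0 < z.im} ∧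
    (∃ C : ℝ, ∀ z : ℂ, 0 < z.im → ‖F z‖ ≤ C) ∧
    ∀ t : ℝ, F t = inner ℂ ξ (T (t • e) η)

/-- The theory has particles of mass `m`: the mass operator `(P₀² - P⃗²)^{1/2}` has the eigenvalue
`m` on the orthogonal complement of the vacuum. For the vector `ξ` the eigenvalue equation
`(P₀² - P⃗²) ξ = m² ξ` is the Klein-Gordon equation `(□ + m²) T(x) ξ = 0`, in the sense of
distributions. -/
def VacuumRep.HasParticlesOfMass {N : LocalNet A} {ω₀ : A →ₚ[ℂ] ℂ} (v : VacuumRep N ω₀ H)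
    (m : ℝ) : Prop :=
  0 ≤ m ∧ ∃ ξ : H, ξ ≠ 0 ∧ inner ℂ v.Ω ξ = 0 ∧
    ∀ φ : TestFn, ∫ x, (box φ x + m ^ 2 * φ x) • v.T x ξ = 0

/-- The massless case. -/
def VacuumRep.Massless {N : LocalNet A} {ω₀ : A →ₚ[ℂ] ℂ} (v : VacuumRep N ω₀ H) : Prop :=
  v.HasParticlesOfMass 0

/-- The massive case: only masses `m > 0` occur. -/
def VacuumRep.Massive {N : LocalNet A} {ω₀ : A →ₚ[ℂ] ℂ} (v : VacuumRep N ω₀ H) : Prop :=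
  ∀ m, v.HasParticlesOfMass m → 0 < m

/-- The conjectured relation, for the thermal state `ω` of the theory with vacuum `v`, between
mass and space-like decay: rate `δ ≤ 1` (and not better) in the massless case, rate `δ > 1` in
the massive case. -/
def MassDecayConjecture {N : LocalNet A} {ω₀ : A →ₚ[ℂ] ℂ} (v : VacuumRep N ω₀ H)
    (ω : A →ₚ[ℂ] ℂ) : Prop :=
  (v.Massless →
    (∃ δ, 0 < δ ∧ δ ≤ 1 ∧ ClustersWithRate N ω δ) ∧ ∀ δ, ClustersWithRate N ω δ → δ ≤ 1) ∧
  (v.Massive → ∃ δ, 1 < δ ∧ ClustersWithRate N ω δ)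

end Net

end ThermalQFT

end

/-! Masses are nonnegative, so if mass 0 does not occur, the theory is massive and the conjecture
supplies a clustering rate δ > 1. Such clustering forces every limit c of the charge commutator to
vanish (`ConservedCurrent.limit_chargeComm_eq_zero`), which contradicts the symmetry breaking.

The engine is Bogoliubov's inequality for KMS states (`ThermalRep.bogoliubov`): for a self-adjoint
charge Q, an observable B and every l > 0, 2 |⟨[Q, B]⟩| ≤ l |⟨[Q, Q̇]⟩| + l⁻¹ β (‖BΩ‖² + ‖B*Ω‖²).
Take for Q the charge smeared over a region of size n, and for B the average of the translates of a
over an n × n square, minus its mean. Three facts combine. (1) Locality: for large n all these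
translates lie deep inside the plateau of the cutoff, so ⟨[Q, B]⟩ = c (`exists_chargeComm_eq`). (2)
Current conservation turns Q̇ into a spatial divergence, and space-like commutativity makes ⟨[Q,
Q̇]⟩ a finite-range quadratic form in the cutoff whose kernel has sum zero. It is therefore
controlled by squared gradients, n³ · n⁻² = n in total (`exists_commutator_le`,
`exists_lattice_form_le`). (3) Clustering with δ > 1 gives ‖BΩ‖² = o(1/n) (`tendsto_fluctuation`). A
square has the least dimension for which this works: averages along a line would only give O(1/n).
With l = m/n the inequality becomes 2|c| ≤ mC + o(1); then n → ∞ and m → 0 give c = 0.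

Two technical points remain. The cutoffs are built from a lattice partition of unity, so that
derivatives become lattice differences and (2) is a finite computation. The charge is unbounded, so
Bogoliubov's inequality is stated for vectors in the closure of {cΩ : c = c*};
`apply_Ω_mem_selfAdjointVectors` places J₀(f)Ω there, by means of bounded approximants read off from
the projection onto the graph. -/

noncomputable section

namespace ThermalQFT

/-! ### Lattice sums -/

/-- The lattice `ℤ³`. -/
abbrev Lattice : Type := Fin 3 → ℤ

/-- The cube of lattice points with coordinates bounded by `N`. -/
def latticeBox (N : ℕ) : Finset Lattice :=
  Fintype.piFinset fun _ => Finset.Icc (-(N : ℤ)) N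

/-- A Lipschitz cutoff on the lattice: `1` for `‖k‖ ≤ 4 * n` and `0` for `‖k‖ ≥ 5 * n`. -/
def latticeCutoff (n : ℕ) (k : Lattice) : ℝ := max 0 (min 1 (5 - ‖k‖ / n))

theorem mem_latticeBox {N : ℕ} {k : Lattice} : k ∈ latticeBox N ↔ ‖k‖ ≤ N := by
  rw [latticeBox, Fintype.mem_piFinset, pi_norm_le_iff_of_nonneg (Nat.cast_nonneg _)]
  refine forall_congr' fun i => ?_
  rw [Finset.mem_Icc, ← abs_le, Int.norm_eq_abs]
  exact_mod_cast Iff.rfl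

theorem card_latticeBox (N : ℕ) : (latticeBox N).card = (2 * N + 1) ^ 3 := by
  simp only [latticeBox, Fintype.card_piFinset, Int.card_Icc, Finset.prod_const, Finset.card_univ,
    Fintype.card_fin]
  congr 1
  omega

theorem latticeCutoff_eq_one {n : ℕ} (hn : 0 < n) {k : Lattice} (hk : ‖k‖ ≤ 4 * n) :
    latticeCutoff n k = 1 := by
  have hn' : (0 : ℝ) < n := by exact_mod_cast hn
  have : ‖k‖ / n ≤ 4 := by rwa [div_le_iff₀ hn']
  rw [latticeCutoff, min_eq_left (by linarith), max_eq_right zero_le_one]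

theorem norm_lt_of_latticeCutoff_ne_zero {n : ℕ} (hn : 0 < n) {k : Lattice}
    (hk : latticeCutoff n k ≠ 0) : ‖k‖ < 5 * n := by
  have hn' : (0 : ℝ) < n := by exact_mod_cast hn
  by_contra! h
  have : 5 ≤ ‖k‖ / n := by rwa [le_div_iff₀ hn']
  exact hk (by rw [latticeCutoff, max_eq_left ((min_le_right _ _).trans (by linarith))])

theorem abs_latticeCutoff_sub_le (n : ℕ) (k l : Lattice) :
    |latticeCutoff n k - latticeCutoff n l| ≤ ‖k - l‖ / n := by
  have h1 : |latticeCutoff n k - latticeCutoff n l| ≤ |(5 - ‖k‖ / n) - (5 - ‖l‖ / n)| := by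
    rw [latticeCutoff, latticeCutoff, max_comm 0, max_comm 0]
    refine (abs_max_sub_max_le_abs _ _ 0).trans ?_
    refine (abs_min_sub_min_le_max _ _ _ _).trans ?_
    simp
  refine h1.trans ?_
  have : (5 - ‖k‖ / n) - (5 - ‖l‖ / n) = (‖l‖ - ‖k‖) / n := by ring
  rw [this, abs_div, Nat.abs_cast, abs_sub_comm]
  gcongr
  exact abs_norm_sub_norm_le k l

/-- A translation invariant quadratic form of finite range on the lattice, whose kernel has
vanishing sum, grows at most linearly on the cutoffs `latticeCutoff n`. -/
theorem exists_lattice_form_le (κ : Lattice → ℝ) (hfin : (Function.support κ).Finite)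
    (hsum : ∑ᶠ z, κ z = 0) :
    ∃ C : ℝ, ∀ᶠ n : ℕ in atTop,
      |∑ k ∈ latticeBox (6 * n), ∑ l ∈ latticeBox (6 * n),
        κ (k - l) * (latticeCutoff n k * latticeCutoff n l)| ≤ C * n := by
  obtain ⟨r, hr⟩ := hfin.isBounded.exists_norm_le
  set M : ℝ := ∑ z ∈ hfin.toFinset, |κ z| * ‖z‖ ^ 2 with hM
  have hM0 : 0 ≤ M := Finset.sum_nonneg fun z _ => by positivity
  refine ⟨13 ^ 3 * M, ?_⟩
  filter_upwards [eventually_ge_atTop (max ⌈r⌉₊ 1)] with n hn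
  have hn1 : 0 < n := lt_of_lt_of_le one_pos ((le_max_right _ _).trans hn)
  have hn' : (0 : ℝ) < n := by exact_mod_cast hn1
  have hrn : r ≤ n := (Nat.le_ceil r).trans (by exact_mod_cast (le_max_left _ _).trans hn)
  set B := latticeBox (6 * n) with hB
  set G := latticeCutoff n with hG
  -- The cutoff lives in radius 5n and the kernel has range at most n, so the box of radius 6n
  -- contains every `l` that contributes: the row is complete.
  have row (k : Lattice) (hk : G k ≠ 0) : ∑ l ∈ B, κ (k - l) = 0 := by
    rw [← finsum_eq_sum_of_support_subset, ← hsum]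
    · exact finsum_comp_equiv (Equiv.subLeft k) (f := κ)
    · intro l hl
      rw [Finset.mem_coe, hB, mem_latticeBox]
      have h1 := hr (k - l) hl
      have h2 := norm_lt_of_latticeCutoff_ne_zero hn1 hk
      have h3 : ‖l‖ ≤ ‖k‖ + ‖k - l‖ := by simpa using norm_sub_le k (k - l)
      push_cast
      linarith
  have col (l : Lattice) (hl : G l ≠ 0) : ∑ k ∈ B, κ (k - l) = 0 := by
    rw [← finsum_eq_sum_of_support_subset, ← hsum]
    · exact finsum_comp_equiv (Equiv.subRight l) (f := κ)
    · intro k hk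
      rw [Finset.mem_coe, hB, mem_latticeBox]
      have h1 := hr (k - l) hk
      have h2 := norm_lt_of_latticeCutoff_ne_zero hn1 hl
      have h3 : ‖k‖ ≤ ‖k - l‖ + ‖l‖ := by simpa using norm_add_le (k - l) l
      push_cast
      linarith
  have hrow : ∑ k ∈ B, ∑ l ∈ B, κ (k - l) * G k ^ 2 = 0 :=
    Finset.sum_eq_zero fun k _ => by
      rw [← Finset.sum_mul]
      by_cases hk : G k = 0
      · simp [hk]
      · rw [row k hk, zero_mul]
  have hcol : ∑ k ∈ B, ∑ l ∈ B, κ (k - l) * G l ^ 2 = 0 := by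
    rw [Finset.sum_comm]
    refine Finset.sum_eq_zero fun l _ => ?_
    rw [← Finset.sum_mul]
    by_cases hl : G l = 0
    · simp [hl]
    · rw [col l hl, zero_mul]
  -- Polarisation: 2 G(k)G(l) = G(k)² + G(l)² - (G(k) - G(l))², and the two pure squares drop out by
  -- `hrow` and `hcol`. No symmetry of `κ` is needed.
  have hid : ∑ k ∈ B, ∑ l ∈ B, κ (k - l) * (G k * G l)
      = -(1 / 2) * ∑ k ∈ B, ∑ l ∈ B, κ (k - l) * (G k - G l) ^ 2 := by
    have : ∑ k ∈ B, ∑ l ∈ B, κ (k - l) * (G k - G l) ^ 2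
        = ∑ k ∈ B, ∑ l ∈ B, κ (k - l) * G k ^ 2 + ∑ k ∈ B, ∑ l ∈ B, κ (k - l) * G l ^ 2
          - 2 * ∑ k ∈ B, ∑ l ∈ B, κ (k - l) * (G k * G l) := by
      simp only [Finset.mul_sum, ← Finset.sum_add_distrib, ← Finset.sum_sub_distrib]
      exact Finset.sum_congr rfl fun k _ => Finset.sum_congr rfl fun l _ => by ring
    rw [this, hrow, hcol]
    ring
  have hinner (k : Lattice) : ∑ l ∈ B, |κ (k - l)| * ‖k - l‖ ^ 2 ≤ M := by
    rw [← Finset.sum_image (s := B) (g := fun l => k - l) (f := fun z => |κ z| * ‖z‖ ^ 2)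
      (fun a _ b _ h => sub_right_injective h)]
    refine (Finset.sum_filter_of_ne (p := (· ∈ hfin.toFinset)) ?_).symm.le.trans ?_
    · intro z _ hz
      rw [Set.Finite.mem_toFinset, Function.mem_support]
      rintro h
      simp [h] at hz
    · refine Finset.sum_le_sum_of_subset_of_nonneg (fun z hz => (Finset.mem_filter.1 hz).2) ?_
      intro z _ _
      positivity
  rw [hid, abs_mul]
  -- Each difference is at most ‖k - l‖/n, so a row contributes at most `M / n ^ 2`, with `M` the
  -- second moment of `|κ|`.
  have hbound : |∑ k ∈ B, ∑ l ∈ B, κ (k - l) * (G k - G l) ^ 2| ≤ B.card * (M / n ^ 2) := by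
    rw [← nsmul_eq_mul]
    refine (Finset.abs_sum_le_sum_abs _ _).trans (Finset.sum_le_card_nsmul _ _ _ fun k _ => ?_)
    refine (Finset.abs_sum_le_sum_abs _ _).trans ?_
    refine le_trans (Finset.sum_le_sum fun l _ => ?_)
      ((Finset.sum_div _ _ _).symm.le.trans
        (div_le_div_of_nonneg_right (hinner k) (by positivity)))
    rw [abs_mul, abs_of_nonneg (sq_nonneg (G k - G l)), mul_div_assoc]
    refine mul_le_mul_of_nonneg_left ?_ (abs_nonneg _)
    rw [← div_pow, ← sq_abs (G k - G l)]
    exact pow_le_pow_left₀ (abs_nonneg _) (abs_latticeCutoff_sub_le n k l) 2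
  have hcard : (B.card : ℝ) ≤ (13 * n) ^ 3 := by
    rw [hB, card_latticeBox]
    push_cast
    have : (1 : ℝ) ≤ n := by exact_mod_cast hn1
    exact pow_le_pow_left₀ (by positivity) (by linarith) 3
  calc |(-(1 / 2) : ℝ)| * |∑ k ∈ B, ∑ l ∈ B, κ (k - l) * (G k - G l) ^ 2|
      ≤ 1 * (B.card * (M / n ^ 2)) := by
        refine mul_le_mul ?_ hbound (abs_nonneg _) zero_le_one
        rw [abs_neg, abs_of_pos] <;> norm_num
    _ ≤ (13 * n) ^ 3 * (M / n ^ 2) := by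
        rw [one_mul]
        exact mul_le_mul_of_nonneg_right hcard (by positivity)
    _ = 13 ^ 3 * M * n := by field_simp

/-! ### Double sums of decaying kernels over a square -/

/-- Every distance from `i` is attained at most twice, once on each side. -/
theorem sum_range_dist_le {x : ℕ → ℝ} (hx : ∀ m, 0 ≤ x m) (n : ℕ) {i : ℕ} (hi : i < n) :
    ∑ i' ∈ Finset.range n, x (Nat.dist i i') ≤ 2 * ∑ m ∈ Finset.range n, x m := by
  have h1 : ∑ i' ∈ Finset.range (i + 1), x (Nat.dist i i') = ∑ m ∈ Finset.range (i + 1), x m := by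
    rw [← Finset.sum_range_reflect x]
    refine Finset.sum_congr rfl fun i' hi' => ?_
    have := Finset.mem_range.1 hi'
    rw [Nat.dist_eq_sub_of_le_right (by omega)]
    congr 1
  have h2 : ∑ i' ∈ Finset.Ico (i + 1) n, x (Nat.dist i i')
      = ∑ m ∈ Finset.range (n - (i + 1)), x (m + 1) := by
    rw [Finset.sum_Ico_eq_sum_range]
    refine Finset.sum_congr rfl fun m _ => ?_
    rw [Nat.dist_eq_sub_of_le (by omega)]
    congr 1
    omega
  have h3 : ∑ m ∈ Finset.range (n - (i + 1)), x (m + 1) ≤ ∑ m ∈ Finset.range n, x m := by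
    refine le_trans ?_ (Finset.sum_le_sum_of_subset_of_nonneg
      (Finset.range_mono (show n - (i + 1) + 1 ≤ n by omega)) fun m _ _ => hx m)
    rw [Finset.sum_range_succ']
    linarith [hx 0]
  have h4 : ∑ m ∈ Finset.range (i + 1), x m ≤ ∑ m ∈ Finset.range n, x m :=
    Finset.sum_le_sum_of_subset_of_nonneg (Finset.range_mono (by omega)) fun m _ _ => hx m
  rw [← Finset.sum_range_add_sum_Ico _ (show i + 1 ≤ n by omega), h1, h2]
  linarith

theorem sum_sum_range_dist_le {x : ℕ → ℝ} (hx : ∀ m, 0 ≤ x m) (n : ℕ) :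
    ∑ i ∈ Finset.range n, ∑ i' ∈ Finset.range n, x (Nat.dist i i')
      ≤ n * (2 * ∑ m ∈ Finset.range n, x m) := by
  refine (Finset.sum_le_card_nsmul _ _ _ fun i hi =>
    sum_range_dist_le hx n (Finset.mem_range.1 hi)).trans ?_
  rw [Finset.card_range, nsmul_eq_mul]

/-- Averages over an `n × n` square of a kernel with product decay of integrable order in one
direction are `o(1/n)`. -/
theorem tendsto_square_average {p q : ℝ} (hp : 1 < p) (hq : 0 < q) :
    Tendsto (fun n : ℕ => (n : ℝ) * (((n : ℝ) ^ 4)⁻¹ *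
      ((∑ i ∈ Finset.range n, ∑ i' ∈ Finset.range n, (1 + (Nat.dist i i' : ℝ)) ^ (-p)) *
        ∑ j ∈ Finset.range n, ∑ j' ∈ Finset.range n, (1 + (Nat.dist j j' : ℝ)) ^ (-q))))
      atTop (𝓝 0) := by
  set x : ℕ → ℝ := fun m => (1 + (m : ℝ)) ^ (-p) with hx
  set y : ℕ → ℝ := fun m => (1 + (m : ℝ)) ^ (-q) with hy
  have hx0 : ∀ m, 0 ≤ x m := fun m => by positivity
  have hy0 : ∀ m, 0 ≤ y m := fun m => by positivity
  have hsx : Summable x := by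
    have := (summable_nat_add_iff 1).2 (Real.summable_nat_rpow.2 (show -p < -1 by linarith))
    refine this.congr fun m => ?_
    simp [hx, add_comm]
  have hy_lim : Tendsto y atTop (𝓝 0) :=
    (tendsto_rpow_neg_atTop hq).comp
      (tendsto_atTop_add_const_left _ _ tendsto_natCast_atTop_atTop)
  -- The summable factor costs a constant; the other one survives as the Cesàro mean of a null
  -- sequence. This is where o(1/n) rather than O(1/n) comes from.
  have hces := (hy_lim.cesaro).const_mul (4 * ∑' m, x m)
  rw [mul_zero] at hces
  refine squeeze_zero' (Eventually.of_forall fun n => ?_) ?_ hces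
  · positivity
  filter_upwards [eventually_gt_atTop 0] with n hn
  have hn' : (0 : ℝ) < n := by exact_mod_cast hn
  have h1 := sum_sum_range_dist_le hx0 n
  have h2 := sum_sum_range_dist_le hy0 n
  have h3 : ∑ m ∈ Finset.range n, x m ≤ ∑' m, x m := hsx.sum_le_tsum _ fun m _ => hx0 m
  calc (n : ℝ) * (((n : ℝ) ^ 4)⁻¹ *
        ((∑ i ∈ Finset.range n, ∑ i' ∈ Finset.range n, x (Nat.dist i i')) *
          ∑ j ∈ Finset.range n, ∑ j' ∈ Finset.range n, y (Nat.dist j j')))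
      ≤ n * (((n : ℝ) ^ 4)⁻¹ * ((n * (2 * ∑' m, x m)) *
          (n * (2 * ∑ m ∈ Finset.range n, y m)))) := by
        gcongr
        exact h1.trans (by gcongr)
    _ = 4 * ∑' m, x m * ((n : ℝ)⁻¹ * ∑ m ∈ Finset.range n, y m) := by
        rw [tsum_mul_right]
        field_simp
        ring
    _ = _ := by rw [tsum_mul_right]; ring

/-! ### Gaussian regularisation along a one-parameter group of isometries -/

/-- The entire function `π^{-1/2} exp (-w²)`. -/
def gaussKernel (w : ℂ) : ℂ := ((√Real.pi)⁻¹ : ℝ) * Complex.exp (-w ^ 2)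

theorem hasDerivAt_gaussKernel (w : ℂ) :
    HasDerivAt gaussKernel (-2 * w * gaussKernel w) w := by
  have h : HasDerivAt (fun w : ℂ => ((√Real.pi)⁻¹ : ℝ) * Complex.exp (-w ^ 2)) _ w :=
    (((hasDerivAt_pow 2 w).neg.cexp).const_mul (((√Real.pi)⁻¹ : ℝ) : ℂ))
  refine h.congr_deriv ?_
  rw [gaussKernel]
  simp only [Pi.neg_apply]
  push_cast
  ring

theorem continuous_gaussKernel : Continuous gaussKernel := by
  unfold gaussKernel
  fun_prop

/-- With w = a + ib the exponent is -(t - a)² + b², and the claim reduces to (t - 2a)² ≥ 0. Half of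
the Gaussian is given up for a bound locally uniform in `w`. -/
theorem norm_gaussKernel_sub_le (t : ℝ) (w : ℂ) :
    ‖gaussKernel (t - w)‖ ≤ (√Real.pi)⁻¹ * Real.exp (‖w‖ ^ 2) * Real.exp (-(1 / 2) * t ^ 2) := by
  rw [gaussKernel, norm_mul, Complex.norm_real, Complex.norm_exp, Real.norm_of_nonneg (by positivity),
    mul_assoc, ← Real.exp_add]
  gcongr
  have h : ‖w‖ ^ 2 = w.re ^ 2 + w.im ^ 2 := by
    rw [← Complex.normSq_eq_norm_sq, Complex.normSq_apply]
    ring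
  rw [h]
  simp [sq]
  nlinarith [sq_nonneg (t - 2 * w.re)]

/-- The linear factor is absorbed by another quarter of the exponent. This is the domination for
differentiating under the integral. -/
theorem norm_gaussKernel_deriv_sub_le (t : ℝ) {w : ℂ} {ρ : ℝ} (hw : ‖w‖ ≤ ρ) :
    ‖2 * ((t : ℂ) - w) * gaussKernel (t - w)‖
      ≤ 2 * (1 + ρ) * ((√Real.pi)⁻¹ * Real.exp (ρ ^ 2)) * Real.exp (-(1 / 4) * t ^ 2) := by
  have hρ : 0 ≤ ρ := (norm_nonneg w).trans hw
  have h1 : ‖(t : ℂ) - w‖ ≤ (1 + ρ) * Real.exp ((1 / 4) * t ^ 2) := by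
    have ht : |t| ≤ Real.exp ((1 / 4) * t ^ 2) :=
      le_trans (by nlinarith [sq_nonneg (|t| / 2 - 1), sq_abs t]) (Real.add_one_le_exp _)
    have h1e : 1 ≤ Real.exp ((1 / 4) * t ^ 2) := Real.one_le_exp (by positivity)
    calc ‖(t : ℂ) - w‖ ≤ |t| + ρ := (norm_sub_le _ _).trans (by
          rw [Complex.norm_real, Real.norm_eq_abs]
          gcongr)
      _ ≤ _ := by nlinarith
  have h2 : ‖gaussKernel (t - w)‖
      ≤ (√Real.pi)⁻¹ * Real.exp (ρ ^ 2) * Real.exp (-(1 / 2) * t ^ 2) :=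
    (norm_gaussKernel_sub_le t w).trans (by gcongr)
  rw [norm_mul, norm_mul]
  have h3 : Real.exp (-(1 / 4) * t ^ 2) = Real.exp ((1 / 4) * t ^ 2) * Real.exp (-(1 / 2) * t ^ 2) := by
    rw [← Real.exp_add]
    congr 1
    ring
  rw [h3]
  calc ‖(2 : ℂ)‖ * ‖(t : ℂ) - w‖ * ‖gaussKernel (t - w)‖
      ≤ 2 * ((1 + ρ) * Real.exp ((1 / 4) * t ^ 2)) *
        ((√Real.pi)⁻¹ * Real.exp (ρ ^ 2) * Real.exp (-(1 / 2) * t ^ 2)) := by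
        gcongr
        simp
    _ = _ := by ring

theorem integral_gaussKernel : ∫ t : ℝ, gaussKernel t = 1 := by
  have h : (fun t : ℝ => gaussKernel t)
      = fun t : ℝ => (((√Real.pi)⁻¹ * Real.exp (-1 * t ^ 2) : ℝ) : ℂ) := by
    funext t
    simp [gaussKernel]
  rw [h, integral_complex_ofReal, integral_const_mul, integral_gaussian, div_one,
    inv_mul_cancel₀ (by positivity), Complex.ofReal_one]

section Conv

variable {E : Type*} [NormedAddCommGroup E] [NormedSpace ℂ E]

/-- The Gaussian average of `u` about the complex point `w`. -/
def gaussConv (u : ℝ → E) (w : ℂ) : E := ∫ t : ℝ, gaussKernel (t - w) • u t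

variable {u : ℝ → E} {C : ℝ}

theorem integrable_gaussConv (hu : Continuous u) (hC : ∀ t, ‖u t‖ ≤ C) (w : ℂ) :
    Integrable fun t : ℝ => gaussKernel (t - w) • u t := by
  have hb := ((integrable_exp_neg_mul_sq (show (0 : ℝ) < 1 / 2 by norm_num)).const_mul
    ((√Real.pi)⁻¹ * Real.exp (‖w‖ ^ 2))).mul_const C
  refine hb.mono' (Continuous.aestronglyMeasurable ?_) (ae_of_all _ fun t => ?_)
  · exact (continuous_gaussKernel.comp (by fun_prop)).smul hu
  · rw [norm_smul]
    exact mul_le_mul (norm_gaussKernel_sub_le t w) (hC t) (norm_nonneg _) (by positivity)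

theorem norm_gaussConv_le (hC : ∀ t, ‖u t‖ ≤ C) (w : ℂ) :
    ‖gaussConv u w‖ ≤ ((√Real.pi)⁻¹ * Real.exp (‖w‖ ^ 2) *
      ∫ t : ℝ, Real.exp (-(1 / 2) * t ^ 2)) * C := by
  have hb := ((integrable_exp_neg_mul_sq (show (0 : ℝ) < 1 / 2 by norm_num)).const_mul
    ((√Real.pi)⁻¹ * Real.exp (‖w‖ ^ 2))).mul_const C
  rw [← integral_const_mul, ← integral_mul_const]
  refine norm_integral_le_of_norm_le hb (ae_of_all _ fun t => ?_)
  rw [norm_smul]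
  exact mul_le_mul (norm_gaussKernel_sub_le t w) (hC t) (norm_nonneg _) (by positivity)

theorem differentiable_gaussConv [CompleteSpace E] (hu : Continuous u) (hC : ∀ t, ‖u t‖ ≤ C) :
    Differentiable ℂ (gaussConv u) := by
  intro w
  have hb := ((integrable_exp_neg_mul_sq (show (0 : ℝ) < 1 / 4 by norm_num)).const_mul
    (2 * (1 + (‖w‖ + 1)) * ((√Real.pi)⁻¹ * Real.exp ((‖w‖ + 1) ^ 2)))).mul_const C
  refine (hasDerivAt_integral_of_dominated_loc_of_deriv_le (𝕜 := ℂ)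
    (F := fun w (t : ℝ) => gaussKernel (t - w) • u t)
    (F' := fun w (t : ℝ) => (2 * ((t : ℂ) - w) * gaussKernel (t - w)) • u t)
    (Metric.ball_mem_nhds w one_pos) ?_ (integrable_gaussConv hu hC w) ?_
    (ae_of_all _ fun t z hz => ?_) hb (ae_of_all _ fun t z _ => ?_)).2.differentiableAt
  · exact Eventually.of_forall fun z => (integrable_gaussConv hu hC z).aestronglyMeasurable
  · refine Continuous.aestronglyMeasurable ?_
    exact (Continuous.mul (by fun_prop) (continuous_gaussKernel.comp (by fun_prop))).smul hu
  · rw [norm_smul]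
    refine mul_le_mul (norm_gaussKernel_deriv_sub_le t ?_) (hC t) (norm_nonneg _) (by positivity)
    have := norm_sub_norm_le z w
    rw [Metric.mem_ball, dist_eq_norm] at hz
    linarith
  · have h1 : HasDerivAt (fun z : ℂ => (t : ℂ) - z) (-1) z := (hasDerivAt_id z).const_sub _
    have h2 := (hasDerivAt_gaussKernel (t - z)).comp z h1
    refine HasDerivAt.smul_const ?_ _
    exact h2.congr_deriv (by ring)

theorem gaussConv_add (u : ℝ → E) (s : ℝ) (w : ℂ) :
    gaussConv u (w + s) = gaussConv (fun t => u (t + s)) w := by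
  unfold gaussConv
  rw [← integral_add_right_eq_self (fun t : ℝ => gaussKernel (t - (w + s)) • u t) s]
  refine integral_congr_ae (ae_of_all _ fun t => ?_)
  dsimp only
  congr 2
  push_cast
  ring

end Conv

/-- A strongly continuous one-parameter group of linear isometries. -/
structure IsometryGroup (E : Type*) [NormedAddCommGroup E] [NormedSpace ℂ E] where
  map : ℝ → (E →ₗᵢ[ℂ] E)
  map_add : ∀ s t x, map (s + t) x = map s (map t x)
  map_zero : ∀ x, map 0 x = x
  cont : ∀ x, Continuous fun t => map t x

namespace IsometryGroup

variable {E E' : Type*} [NormedAddCommGroup E] [NormedSpace ℂ E]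
  [NormedAddCommGroup E'] [NormedSpace ℂ E'] (V : IsometryGroup E) (V' : IsometryGroup E')

/-- The Gaussian regularisation of width `ε` of the orbit of `x`, an entire function. -/
def regularize (ε : ℝ) (x : E) (z : ℂ) : E := gaussConv (fun t => V.map (ε * t) x) (z / ε)

theorem continuous_orbit (ε : ℝ) (x : E) : Continuous fun t => V.map (ε * t) x :=
  (V.cont x).comp (continuous_const_mul ε)

theorem norm_orbit_le (ε : ℝ) (x : E) (t : ℝ) : ‖V.map (ε * t) x‖ ≤ ‖x‖ :=
  (LinearIsometry.norm_map _ _).le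

theorem differentiable_regularize [CompleteSpace E] (ε : ℝ) (x : E) :
    Differentiable ℂ (V.regularize ε x) :=
  (differentiable_gaussConv (V.continuous_orbit ε x) (V.norm_orbit_le ε x)).comp
    (differentiable_id.div_const _)

theorem regularize_sub (ε : ℝ) (x y : E) (z : ℂ) :
    V.regularize ε (x - y) z = V.regularize ε x z - V.regularize ε y z := by
  unfold regularize gaussConv
  rw [← integral_sub (integrable_gaussConv (V.continuous_orbit ε x) (V.norm_orbit_le ε x) _)
    (integrable_gaussConv (V.continuous_orbit ε y) (V.norm_orbit_le ε y) _)]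
  simp only [map_sub, smul_sub]

theorem map_regularize_of_intertwining [CompleteSpace E] [CompleteSpace E'] (L : E →L[ℂ] E')
    (hL : ∀ t x, L (V.map t x) = V'.map t (L x)) (ε : ℝ) (x : E) (z : ℂ) :
    L (V.regularize ε x z) = V'.regularize ε (L x) z := by
  unfold regularize gaussConv
  rw [← L.integral_comp_comm
    (integrable_gaussConv (V.continuous_orbit ε x) (V.norm_orbit_le ε x) _)]
  simp only [map_smul, hL]

theorem map_regularize [CompleteSpace E] {ε : ℝ} (hε : ε ≠ 0) (x : E) (s : ℝ) (z : ℂ) :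
    V.map s (V.regularize ε x z) = V.regularize ε x (z + s) := by
  have h := map_regularize_of_intertwining V V (V.map s).toContinuousLinearMap
    (fun t x => by
      change V.map s (V.map t x) = V.map t (V.map s x)
      rw [← V.map_add, ← V.map_add, add_comm]) ε x z
  refine h.trans ?_
  have h2 : (z + s) / ε = z / ε + ((s / ε : ℝ) : ℂ) := by
    push_cast
    ring
  rw [regularize, regularize, h2, gaussConv_add]
  congr 1
  funext t
  change V.map (ε * t) (V.map s x) = _
  rw [← V.map_add]
  congr 2
  field_simp

/-- The point `ε = 0` may stay in the filter: there the orbit is constant and the kernel integrates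
to one. -/
theorem tendsto_regularize [CompleteSpace E] (x : E) :
    Tendsto (fun ε => V.regularize ε x 0) (𝓝 0) (𝓝 x) := by
  have h : x = ∫ t : ℝ, gaussKernel (t - 0) • x := by
    simp only [sub_zero]
    rw [integral_smul_const, integral_gaussKernel, one_smul]
  have hfun : (fun ε => V.regularize ε x 0)
      = fun ε => ∫ t : ℝ, gaussKernel (t - 0) • V.map (ε * t) x := by
    funext ε
    simp [regularize, gaussConv]
  rw [hfun]
  conv => rhs; rw [h]
  refine tendsto_integral_filter_of_dominated_convergence
    (fun t : ℝ => (√Real.pi)⁻¹ * Real.exp (‖(0 : ℂ)‖ ^ 2) * Real.exp (-(1 / 2) * t ^ 2) * ‖x‖)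
    (Eventually.of_forall fun ε =>
      (integrable_gaussConv (V.continuous_orbit ε x) (V.norm_orbit_le ε x) 0).aestronglyMeasurable)
    (Eventually.of_forall fun ε => ae_of_all _ fun t => ?_)
    (((integrable_exp_neg_mul_sq (by norm_num)).const_mul _).mul_const _)
    (ae_of_all _ fun t => ?_)
  · rw [norm_smul]
    exact mul_le_mul (norm_gaussKernel_sub_le t 0) (V.norm_orbit_le ε x t) (norm_nonneg _)
      (by positivity)
  · refine Tendsto.const_smul ?_ _
    have : Tendsto (fun ε : ℝ => V.map (ε * t) x) (𝓝 0) (𝓝 (V.map (0 * t) x)) :=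
      ((V.cont x).comp (continuous_mul_const t)).tendsto 0
    simpa [V.map_zero] using this

theorem continuous_regularize (ε : ℝ) (z : ℂ) : Continuous fun x => V.regularize ε x z := by
  refine continuous_iff_continuousAt.2 fun x => ?_
  refine tendsto_iff_norm_sub_tendsto_zero.2 ?_
  refine squeeze_zero (fun _ => norm_nonneg _) (fun y => ?_) ?_ (g := fun y =>
    ((√Real.pi)⁻¹ * Real.exp (‖z / ε‖ ^ 2) * ∫ t : ℝ, Real.exp (-(1 / 2) * t ^ 2)) * ‖y - x‖)
  · rw [← V.regularize_sub]
    exact norm_gaussConv_le (V.norm_orbit_le ε _) _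
  · have : Tendsto (fun y => ‖y - x‖) (𝓝 x) (𝓝 0) := tendsto_norm_sub_self x
    simpa using this.const_mul _

/-- Cauchy's estimate on the unit circle bounds the derivative by ‖y - x‖. On regularised vectors
the generator thus acts continuously, which permits passing to closures at fixed `ε`. -/
theorem continuous_deriv_regularize [CompleteSpace E] (ε : ℝ) :
    Continuous fun x => deriv (V.regularize ε x) 0 := by
  refine continuous_iff_continuousAt.2 fun x => ?_
  refine tendsto_iff_norm_sub_tendsto_zero.2 ?_
  refine squeeze_zero (fun _ => norm_nonneg _) (fun y => ?_) ?_ (g := fun y =>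
    ((√Real.pi)⁻¹ * Real.exp ((1 / |ε|) ^ 2) * ∫ t : ℝ, Real.exp (-(1 / 2) * t ^ 2)) * ‖y - x‖)
  · rw [← deriv_sub (V.differentiable_regularize ε y 0) (V.differentiable_regularize ε x 0)]
    have hfun : V.regularize ε y - V.regularize ε x = V.regularize ε (y - x) := by
      funext z
      rw [Pi.sub_apply, V.regularize_sub]
    rw [hfun]
    refine (Complex.norm_deriv_le_of_forall_mem_sphere_norm_le one_pos
      (V.differentiable_regularize ε (y - x)).diffContOnCl fun z hz => ?_).trans_eq (div_one _)
    refine (norm_gaussConv_le (V.norm_orbit_le ε _) _).trans ?_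
    rw [norm_div, mem_sphere_zero_iff_norm.1 hz, Complex.norm_real, Real.norm_eq_abs]
  · have : Tendsto (fun y => ‖y - x‖) (𝓝 x) (𝓝 0) := tendsto_norm_sub_self x
    simpa using this.const_mul _

/-- Regularisation commutes with the generator. -/
theorem deriv_regularize [CompleteSpace E] {ε : ℝ} (hε : ε ≠ 0) {x x' : E}
    (hx : HasDerivAt (fun t => V.map t x) x' 0) :
    deriv (V.regularize ε x) 0 = V.regularize ε x' 0 := by
  -- Regularisation at 0 as a bounded operator. Both sides of the claim are the derivative at 0 of
  -- `t ↦ P (V.map t x)`, which equals `t ↦ V.regularize ε x t`.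
  let P : E →L[ℂ] E := LinearMap.mkContinuous
    { toFun := fun y => V.regularize ε y 0
      map_add' := fun y y' => by
        have := V.regularize_sub ε (y + y') y' 0
        rw [add_sub_cancel_right] at this
        rw [this, sub_add_cancel]
      map_smul' := fun c y => by
        simp only [regularize, gaussConv, map_smul, RingHom.id_apply]
        rw [← integral_smul]
        simp only [smul_comm c] }
    _ (fun y => norm_gaussConv_le (V.norm_orbit_le ε y) _)
  have h1 : HasDerivAt (fun t : ℝ => P (V.map t x)) (P x') 0 := by
    exact (P.restrictScalars ℝ).hasFDerivAt.comp_hasDerivAt (0 : ℝ) hx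
  have h2 : (fun t : ℝ => P (V.map t x)) = fun t : ℝ => V.regularize ε x t := by
    funext t
    have h3 := map_regularize_of_intertwining V V (V.map t).toContinuousLinearMap
      (fun s x => by
        change V.map t (V.map s x) = V.map s (V.map t x)
        rw [← V.map_add, ← V.map_add, add_comm]) ε x 0
    have h4 := V.map_regularize hε x t 0
    rw [zero_add] at h4
    exact h3.symm.trans h4
  rw [h2] at h1
  have h5 : HasDerivAt (fun t : ℝ => V.regularize ε x t) (deriv (V.regularize ε x) 0) 0 := by
    have h6 := (V.differentiable_regularize ε x 0).hasDerivAt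
    have : HasDerivAt (V.regularize ε x) (deriv (V.regularize ε x) 0) ((0 : ℝ) : ℂ) := by
      simpa using h6
    have h7 := HasDerivAt.scomp (0 : ℝ) this (Complex.ofRealCLM.hasDerivAt (x := (0 : ℝ)))
    simpa [Function.comp_def] using h7
  exact h5.unique h1

end IsometryGroup

/-! ### Functions on a strip -/

/-- Multiplying by exp(inz) leaves the lower edge at zero and damps the upper one by exp(-nβ).
Phragmén–Lindelöf then gives |G(w)| ≤ M exp(-n(β - Im w)), and n → ∞ settles everything below the
upper edge; the edge itself follows by continuity. -/
theorem eq_zero_of_bounded_strip {G : ℂ → ℂ} {β M : ℝ} (hβ : 0 < β)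
    (hc : ContinuousOn G {z | 0 ≤ z.im ∧ z.im ≤ β})
    (hd : DifferentiableOn ℂ G {z | 0 < z.im ∧ z.im < β})
    (hM : ∀ z : ℂ, 0 ≤ z.im → z.im ≤ β → ‖G z‖ ≤ M) (h0 : ∀ t : ℝ, G t = 0)
    {z : ℂ} (hz0 : 0 ≤ z.im) (hzβ : z.im ≤ β) : G z = 0 := by
  have hM0 : 0 ≤ M := (norm_nonneg _).trans (hM 0 (by simp) (by simpa using hβ.le))
  have hinter : ∀ w : ℂ, 0 ≤ w.im → w.im < β → G w = 0 := by
    intro w hw0 hwβ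
    have key (n : ℕ) : ‖G w‖ ≤ M * Real.exp (-(β - w.im)) ^ n := by
      have hcl : closure (Complex.im ⁻¹' Set.Ioo 0 β) ⊆ {z : ℂ | 0 ≤ z.im ∧ z.im ≤ β} := by
        refine closure_minimal (fun z hz => ⟨hz.1.le, hz.2.le⟩) ?_
        exact (isClosed_le continuous_const Complex.continuous_im).inter
          (isClosed_le Complex.continuous_im continuous_const)
      have hnorm (z : ℂ) : ‖G z * Complex.exp (Complex.I * n * z)‖ = ‖G z‖ * Real.exp (-(n * z.im)) := by
        rw [norm_mul, Complex.norm_exp]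
        congr 2
        simp
      have h := PhragmenLindelof.horizontal_strip (a := 0) (b := β)
        (f := fun z => G z * Complex.exp (Complex.I * n * z)) (C := M * Real.exp (-(n * β))) (z := w)
        ⟨hd.mul (by fun_prop), (hc.mono hcl).mul (by fun_prop)⟩
        ⟨0, by rw [sub_zero]; positivity, 0, ?_⟩ ?_ ?_ hw0 hwβ.le
      · rw [hnorm] at h
        have h2 : ‖G w‖ = ‖G w‖ * Real.exp (-(n * w.im)) * Real.exp (n * w.im) := by
          rw [mul_assoc, ← Real.exp_add, neg_add_cancel, Real.exp_zero, mul_one]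
        rw [h2]
        refine (mul_le_mul_of_nonneg_right h (Real.exp_nonneg _)).trans_eq ?_
        rw [mul_assoc, ← Real.exp_add, ← Real.exp_nat_mul]
        congr 2
        ring
      · refine Asymptotics.IsBigO.of_bound M ?_
        filter_upwards [mem_inf_of_right (mem_principal_self _)] with z hz
        rw [hnorm]
        simp only [zero_mul, Real.exp_zero, norm_one]
        refine mul_le_mul (hM z hz.1.le hz.2.le) ?_ (Real.exp_nonneg _) hM0
        rw [Real.exp_le_one_iff, neg_nonpos]
        exact mul_nonneg (Nat.cast_nonneg _) hz.1.le
      · intro z hz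
        have : z = ((z.re : ℝ) : ℂ) := Complex.ext rfl (by simp [hz])
        rw [this, h0, zero_mul, norm_zero]
        positivity
      · intro z hz
        rw [hnorm, hz]
        gcongr
        exact hM z (by rw [hz]; exact hβ.le) hz.le
    have hlt : Real.exp (-(β - w.im)) < 1 := by
      rw [Real.exp_lt_one_iff]
      linarith
    have hlim := (tendsto_pow_atTop_nhds_zero_of_lt_one (Real.exp_nonneg _) hlt).const_mul M
    rw [mul_zero] at hlim
    exact norm_le_zero_iff.1 (ge_of_tendsto' hlim key)
  rcases hzβ.lt_or_eq with h | h
  · exact hinter z hz0 h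
  · have hcz := hc z ⟨hz0, hzβ⟩
    have hseq : Tendsto (fun ε : ℝ => z - ε * Complex.I) (𝓝[>] 0) (𝓝[{z | 0 ≤ z.im ∧ z.im ≤ β}] z) := by
      refine tendsto_nhdsWithin_iff.2 ⟨?_, ?_⟩
      · have : Tendsto (fun ε : ℝ => z - ε * Complex.I) (𝓝 0) (𝓝 (z - (0 : ℝ) * Complex.I)) :=
          Continuous.tendsto (by fun_prop) 0
        simpa using this.mono_left nhdsWithin_le_nhds
      · filter_upwards [Ioo_mem_nhdsGT hβ] with ε hε
        simp only [Complex.sub_im, Complex.mul_im, Complex.ofReal_re,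
          Complex.I_im, Complex.ofReal_im, Complex.I_re]
        constructor <;> linarith [hε.1, hε.2]
    have h1 := hcz.tendsto.comp hseq
    refine tendsto_nhds_unique h1 (tendsto_const_nhds.congr' ?_)
    filter_upwards [Ioo_mem_nhdsGT hβ] with ε hε
    refine (hinter _ ?_ ?_).symm <;> simp <;> linarith [hε.1, hε.2]

theorem eq_of_eq_on_reals {f g : ℂ → ℂ} (hf : Differentiable ℂ f) (hg : Differentiable ℂ g)
    (h : ∀ t : ℝ, f t = g t) (z : ℂ) : f z = g z := by
  have := AnalyticOnNhd.eq_of_frequently_eq (z₀ := 0)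
    (hf.differentiableOn.analyticOnNhd isOpen_univ) (hg.differentiableOn.analyticOnNhd isOpen_univ) ?_
  · exact congrFun this z
  · have ht : Tendsto (fun t : ℝ => (t : ℂ)) (𝓝[≠] 0) (𝓝[≠] 0) := by
      refine tendsto_nhdsWithin_iff.2 ⟨?_, ?_⟩
      · have : Tendsto (fun t : ℝ => (t : ℂ)) (𝓝 0) (𝓝 ((0 : ℝ) : ℂ)) :=
          Complex.continuous_ofReal.tendsto 0
        simpa using this.mono_left nhdsWithin_le_nhds
      · filter_upwards [self_mem_nhdsWithin] with t ht
        simpa using ht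
    exact ht.frequently (Eventually.of_forall h).frequently

/-! ### Time translations -/

section Net

variable {A : Type*} [CStarAlgebra A]

theorem LocalNet.trans_zero (N : LocalNet A) (a : A) : N.trans 0 a = a := by
  have h := N.trans_add 0 0 a
  rw [add_zero] at h
  exact ((N.trans 0).injective h).symm

/-- Time translations as a group of isometries of the algebra. -/
def LocalNet.timeGroup (N : LocalNet A) : IsometryGroup A where
  map t :=
    { toFun := fun a => N.trans (t, 0) a
      map_add' := map_add _
      map_smul' := fun c a => by simp
      norm_map' := fun a => StarAlgEquiv.norm_map (N.trans (t, 0)) a }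
  map_add s t a := by
    change N.trans (s + t, 0) a = N.trans (s, 0) (N.trans (t, 0) a)
    rw [← N.trans_add]
    simp
  map_zero a := N.trans_zero a
  cont := N.time_continuous

theorem LocalNet.timeGroup_map (N : LocalNet A) (t : ℝ) (a : A) :
    N.timeGroup.map t a = N.trans (t, 0) a := rfl

/-! ### Entire orbits of the time evolution -/

/-- `X` is the analytic continuation of the orbit of `X 0` under time translations. -/
structure IsEntireOrbit (N : LocalNet A) (X : ℂ → A) : Prop where
  diff : Differentiable ℂ X
  map : ∀ (s : ℝ) z, N.trans (s, 0) (X z) = X (z + s)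

namespace IsEntireOrbit

theorem deriv {N : LocalNet A} {X : ℂ → A} (hX : IsEntireOrbit N X) : IsEntireOrbit N
    (deriv X) where
  diff := (hX.diff.contDiff (n := 2)).differentiable_deriv_two
  map s z := by
    have h1 : HasDerivAt (fun z => X (z + s)) (_root_.deriv X (z + s)) z :=
      (hX.diff (z + s)).hasDerivAt.comp_add_const z (s : ℂ)
    have h2 : HasDerivAt (fun z => N.trans (s, 0) (X z)) (N.trans (s, 0) (_root_.deriv X z)) z :=
      ((N.timeGroup.map s).toContinuousLinearMap.hasFDerivAt).comp_hasDerivAt z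
        (hX.diff z).hasDerivAt
    simp only [hX.map] at h2
    exact h2.unique h1

theorem star {N : LocalNet A} {X : ℂ → A} (hX : IsEntireOrbit N X) :
    IsEntireOrbit N fun z => star (X ((starRingEnd ℂ) z)) where
  diff z := by
    have h := (hX.diff ((starRingEnd ℂ) z)).star_conj
    rwa [Complex.conj_conj] at h
  map s z := by
    rw [map_star, hX.map, map_add, Complex.conj_ofReal]

theorem norm_eq {N : LocalNet A} {X : ℂ → A} (hX : IsEntireOrbit N X) (z : ℂ) :
    ‖X z‖ = ‖X (z.im * Complex.I)‖ := by
  have h := hX.map z.re (z.im * Complex.I)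
  rw [add_comm, Complex.re_add_im] at h
  rw [← h, StarAlgEquiv.norm_map]

/-- By covariance the norm depends on Im z only, so compactness of an interval bounds it on the
whole strip. This supplies the growth condition for Phragmén–Lindelöf. -/
theorem exists_norm_le {N : LocalNet A} {X : ℂ → A} (hX : IsEntireOrbit N X) (β : ℝ) :
    ∃ C, ∀ z : ℂ, 0 ≤ z.im → z.im ≤ β → ‖X z‖ ≤ C := by
  have hc : Continuous fun s : ℝ => X (s * Complex.I) := hX.diff.continuous.comp (by fun_prop)
  obtain ⟨C, hC⟩ := (isCompact_Icc (a := (0 : ℝ)) (b := β)).exists_bound_of_continuousOn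
    hc.continuousOn
  exact ⟨C, fun z h0 h1 => (hX.norm_eq z).trans_le (hC z.im ⟨h0, h1⟩)⟩

theorem regularize (N : LocalNet A) {ε : ℝ} (hε : ε ≠ 0) (a : A) :
    IsEntireOrbit N (N.timeGroup.regularize ε a) where
  diff := N.timeGroup.differentiable_regularize ε a
  map s z := N.timeGroup.map_regularize hε a s z

/-- The kernel is real on the real axis, so it commutes with conjugation. -/
theorem star_regularize (N : LocalNet A) (ε : ℝ) {a : A} (ha : Star.star a = a) (z : ℂ) :
    Star.star (N.timeGroup.regularize ε a ((starRingEnd ℂ) z)) = N.timeGroup.regularize ε a z := by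
  unfold IsometryGroup.regularize gaussConv
  have h := (starL' ℝ : A ≃L[ℝ] A).integral_comp_comm (μ := volume)
    (fun t : ℝ => gaussKernel (t - (starRingEnd ℂ) z / ε) • N.timeGroup.map (ε * t) a)
  simp only [starL'_apply] at h
  rw [← h]
  refine integral_congr_ae (ae_of_all _ fun t => ?_)
  dsimp only
  rw [star_smul, LocalNet.timeGroup_map, ← map_star, ha]
  congr 1
  simp only [gaussKernel]
  rw [← starRingEnd_apply, map_mul, Complex.conj_ofReal, ← Complex.exp_conj]
  simp

end IsEntireOrbit

/-! ### Representations -/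

variable [PartialOrder A] [StarOrderedRing A]
variable {H : Type*} [NormedAddCommGroup H] [InnerProductSpace ℂ H] [CompleteSpace H]

namespace InvariantRep

variable {N : LocalNet A} {ω : A →ₚ[ℂ] ℂ} (r : InvariantRep N ω H)

/-- The map `a ↦ a Ω`. -/
def vec : A →L[ℂ] H :=
  LinearMap.mkContinuous
    { toFun := fun a => r.π a r.Ω
      map_add' := fun a b => by simp
      map_smul' := fun c a => by simp } ‖r.Ω‖ fun a => by
    refine ((r.π a).le_opNorm r.Ω).trans ?_
    rw [mul_comm]
    gcongr
    exact NonUnitalStarAlgHom.norm_apply_le r.π a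

theorem vec_apply (a : A) : r.vec a = r.π a r.Ω := rfl

theorem vec_one : r.vec 1 = r.Ω := by simp [vec_apply]

theorem inner_vec (a b : A) : inner ℂ (r.vec a) (r.vec b) = ω (star a * b) := by
  rw [← r.inner_eq, map_mul, map_star, mul_apply_eq_comp,
    ContinuousLinearMap.star_eq_adjoint, ContinuousLinearMap.adjoint_inner_right]
  rfl

theorem T_vec (x : Spacetime) (a : A) : r.T x (r.vec a) = r.vec (N.trans x a) := r.T_apply x a

theorem eq_of_eq_on_vec {E : Type*} [TopologicalSpace E] [T2Space E] {f g : H → E}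
    (hf : Continuous f) (hg : Continuous g) (h : ∀ a, f (r.vec a) = g (r.vec a)) (ξ : H) :
    f ξ = g ξ :=
  congrFun (Continuous.ext_on r.cyclic hf hg (by rintro _ ⟨a, rfl⟩; exact h a)) ξ

/-- The group law holds on the vectors aΩ because the automorphisms form a group, and extends by
cyclicity. -/
theorem T_add (x y : Spacetime) (ξ : H) : r.T (x + y) ξ = r.T x (r.T y ξ) := by
  refine r.eq_of_eq_on_vec (f := fun ξ => r.T (x + y) ξ) (g := fun ξ => r.T x (r.T y ξ))
    (by fun_prop) (by fun_prop) (fun a => ?_) ξ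
  simp only [T_vec, N.trans_add]

theorem T_zero (ξ : H) : r.T 0 ξ = ξ := by
  have h := r.T_add 0 0 ξ
  rw [add_zero] at h
  exact ((r.T 0).injective h).symm

theorem T_Ω (x : Spacetime) : r.T x r.Ω = r.Ω := by
  rw [← r.vec_one, T_vec, map_one]

/-- Time translations as a unitary group. -/
def timeUnitary : IsometryGroup H where
  map t := (r.T (t, 0)).toLinearIsometry
  map_add s t ξ := by
    change r.T (s + t, 0) ξ = r.T (s, 0) (r.T (t, 0) ξ)
    rw [← r.T_add]
    simp
  map_zero ξ := r.T_zero ξ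
  cont ξ := (r.T_continuous ξ).comp (by fun_prop)

theorem timeUnitary_map (t : ℝ) (ξ : H) : r.timeUnitary.map t ξ = r.T (t, 0) ξ := rfl

theorem vec_timeGroup (t : ℝ) (a : A) :
    r.vec (N.timeGroup.map t a) = r.timeUnitary.map t (r.vec a) := by
  rw [LocalNet.timeGroup_map, timeUnitary_map, T_vec]

/-- The state as a continuous functional. -/
def functional : A →L[ℂ] ℂ := (innerSL ℂ r.Ω).comp r.vec

theorem functional_apply (a : A) : r.functional a = ω a := r.inner_eq a

end InvariantRep

end Net

/-! ### The Bogoliubov inequality -/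

section Net

variable {A : Type*} [CStarAlgebra A] [PartialOrder A] [StarOrderedRing A]
variable {H : Type*} [NormedAddCommGroup H] [InnerProductSpace ℂ H] [CompleteSpace H]
variable {N : LocalNet A} {ω : A →ₚ[ℂ] ℂ}

namespace InvariantRep

theorem norm_functional_mul_le (r : InvariantRep N ω H) (a b : A) :
    ‖ω (a * b)‖ ≤ ‖r.functional‖ * (‖a‖ * ‖b‖) := by
  rw [← r.functional_apply]
  refine (r.functional.le_opNorm _).trans ?_
  gcongr
  exact norm_mul_le a b

theorem differentiable_state_mul (r : InvariantRep N ω H) {X Y : ℂ → A} (hX : Differentiable ℂ X)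
    (hY : Differentiable ℂ Y) :
    Differentiable ℂ fun w => ω (X w * Y w) := by
  simp only [← r.functional_apply]
  exact r.functional.differentiable.comp (hX.mul hY)

/-- Invariance holds for real shifts; both sides are entire in the shift, so it persists for complex
ones. -/
theorem state_orbit_invariant (r : InvariantRep N ω H) {X Y : ℂ → A} (hX : IsEntireOrbit N X)
    (hY : IsEntireOrbit N Y)
    (z u w : ℂ) : ω (X (z + w) * Y (u + w)) = ω (X z * Y u) := by
  refine eq_of_eq_on_reals (f := fun w => ω (X (z + w) * Y (u + w))) (g := fun _ => ω (X z * Y u))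
    (r.differentiable_state_mul (hX.diff.comp (by fun_prop)) (hY.diff.comp (by fun_prop)))
    (differentiable_const _) (fun t => ?_) w
  rw [← hX.map, ← hY.map, ← map_mul, r.invariant]

/-- The infinitesimal form of invariance: the Leibniz rule applied to a constant function. -/
theorem state_deriv_swap (r : InvariantRep N ω H) {X Y : ℂ → A} (hX : IsEntireOrbit N X)
    (hY : IsEntireOrbit N Y)
    (z u : ℂ) : ω (X z * deriv Y u) = -ω (deriv X z * Y u) := by
  have h1 : HasDerivAt (fun w => X (z + w)) (deriv X z) 0 := by
    have := (hX.diff (z + 0)).hasDerivAt.comp_const_add z 0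
    simpa using this
  have h2 : HasDerivAt (fun w => Y (u + w)) (deriv Y u) 0 := by
    have := (hY.diff (u + 0)).hasDerivAt.comp_const_add u 0
    simpa using this
  have h3 := r.functional.hasFDerivAt.comp_hasDerivAt (0 : ℂ) (h1.mul h2)
  have h4 : HasDerivAt (fun _ : ℂ => ω (X z * Y u)) 0 0 := hasDerivAt_const _ _
  have h5 : (r.functional ∘ ((fun w => X (z + w)) * fun w => Y (u + w)))
      = fun _ : ℂ => ω (X z * Y u) := by
    funext w
    simp only [Function.comp_apply, Pi.mul_apply, r.functional_apply]
    exact r.state_orbit_invariant hX hY z u w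
  rw [h5] at h3
  have h6 := h3.unique h4
  rw [r.functional_apply, map_add] at h6
  simp only [add_zero] at h6
  exact eq_neg_of_add_eq_zero_right h6

/-- Analytically continued correlations as inner products. -/
theorem state_star_orbit (r : InvariantRep N ω H) {X Y : ℂ → A} (hX : IsEntireOrbit N X)
    (hY : IsEntireOrbit N Y) (s : ℝ) :
    ω (star (X 0) * Y (s * Complex.I))
      = inner ℂ (r.vec (X ((s / 2 : ℝ) * Complex.I))) (r.vec (Y ((s / 2 : ℝ) * Complex.I))) := by
  -- Shifting both arguments by -is/2 distributes the imaginary time evenly over the two factors.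
  have h := r.state_orbit_invariant hX.star hY 0 (s * Complex.I) (-((s / 2 : ℝ) * Complex.I))
  rw [map_zero] at h
  rw [r.inner_vec, ← h]
  congr 2
  · congr 2
    rw [zero_add, map_neg, map_mul, Complex.conj_ofReal, Complex.conj_I]
    ring
  · congr 1
    push_cast
    ring

end InvariantRep

namespace ThermalRep

variable {β : ℝ}

/-- The KMS function F and z ↦ ω(a Y(z)) agree on the lower edge of the strip and are bounded, so
their difference vanishes up to the upper edge, where F has the reversed order. -/
theorem state_kms_orbit (r : ThermalRep N ω β H) (a : A) {Y : ℂ → A} (hY : IsEntireOrbit N Y)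
    (t : ℝ) :
    ω (a * Y (t + β * Complex.I)) = ω (Y t * a) := by
  obtain ⟨F, hFc, hFd, ⟨C, hFb⟩, hF0, hFβ⟩ := r.kms a (Y 0)
  obtain ⟨C', hC'⟩ := hY.exists_norm_le β
  set f := r.toInvariantRep.functional
  have hYd : Differentiable ℂ fun z => ω (a * Y z) :=
    r.toInvariantRep.differentiable_state_mul (differentiable_const a) hY.diff
  have hYb (z : ℂ) (h0 : 0 ≤ z.im) (h1 : z.im ≤ β) : ‖ω (a * Y z)‖ ≤ ‖f‖ * (‖a‖ * C') :=
    (r.toInvariantRep.norm_functional_mul_le a (Y z)).trans (by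
      gcongr
      exact hC' z h0 h1)
  have hFb' (z : ℂ) (h0 : 0 ≤ z.im) (h1 : z.im ≤ β) :
      ‖F z‖ ≤ max C (‖f‖ * (‖a‖ * ‖Y 0‖)) := by
    rcases h0.eq_or_lt with h0 | h0
    · have : z = ((z.re : ℝ) : ℂ) := Complex.ext rfl (by simp [← h0])
      rw [this, hF0]
      refine (r.toInvariantRep.norm_functional_mul_le _ _).trans (le_max_of_le_right ?_)
      rw [StarAlgEquiv.norm_map]
    · rcases h1.eq_or_lt with h1 | h1
      · have : z = (z.re : ℝ) + Complex.I * β := by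
          rw [← h1, mul_comm, Complex.re_add_im]
        rw [this, hFβ]
        refine (r.toInvariantRep.norm_functional_mul_le _ _).trans (le_max_of_le_right ?_)
        rw [StarAlgEquiv.norm_map, mul_comm ‖a‖]
      · exact (hFb z h0 h1).trans (le_max_left _ _)
  have h := eq_zero_of_bounded_strip (G := fun z => F z - ω (a * Y z)) r.β_pos
    (hFc.sub hYd.continuous.continuousOn) (hFd.sub hYd.differentiableOn)
    (fun z h0 h1 => (norm_sub_le _ _).trans (add_le_add (hFb' z h0 h1) (hYb z h0 h1)))
    (fun t => by rw [hF0, hY.map, zero_add, sub_self]) (z := t + β * Complex.I)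
    (by simpa using r.β_pos.le) (by simp)
  rw [mul_comm (β : ℂ), hFβ, sub_eq_zero, hY.map, zero_add, mul_comm Complex.I] at h
  exact h.symm

/-- A maximum principle for z ↦ ω(X(0)* X(z)): its value at is is the left side, the lower edge is
bounded by ‖X(0)Ω‖² and, through KMS, the upper edge by ‖X(0)*Ω‖². -/
theorem norm_vec_orbit_sq_le (r : ThermalRep N ω β H) {X : ℂ → A} (hX : IsEntireOrbit N X)
    {s : ℝ} (h0 : 0 ≤ s) (h1 : s ≤ β) :
    ‖r.vec (X ((s / 2 : ℝ) * Complex.I))‖ ^ 2 ≤ ‖r.vec (X 0)‖ ^ 2 + ‖r.vec (star (X 0))‖ ^ 2 := by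
  obtain ⟨C', hC'⟩ := hX.exists_norm_le β
  have hd : Differentiable ℂ fun z => ω (star (X 0) * X z) :=
    r.toInvariantRep.differentiable_state_mul (differentiable_const _) hX.diff
  have h := PhragmenLindelof.horizontal_strip (a := 0) (b := β)
    (f := fun z => ω (star (X 0) * X z)) (C := ‖r.vec (X 0)‖ ^ 2 + ‖r.vec (star (X 0))‖ ^ 2)
    (z := s * Complex.I) hd.diffContOnCl
    ⟨0, by rw [sub_zero]; exact div_pos Real.pi_pos r.β_pos, 0, ?_⟩ ?_ ?_
    (by simpa using h0) (by simpa using h1)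
  · rw [r.toInvariantRep.state_star_orbit hX hX, inner_self_eq_norm_sq_to_K] at h
    simpa using h
  · refine Asymptotics.IsBigO.of_bound (‖r.functional‖ * (‖star (X 0)‖ * C')) ?_
    filter_upwards [mem_inf_of_right (mem_principal_self _)] with z hz
    simp only [zero_mul, Real.exp_zero, norm_one, mul_one]
    refine (r.toInvariantRep.norm_functional_mul_le _ _).trans ?_
    gcongr
    exact hC' z hz.1.le hz.2.le
  · intro z hz
    have : z = 0 + ((z.re : ℝ) : ℂ) := Complex.ext (by simp) (by simp [hz])
    rw [this, ← hX.map, ← r.toInvariantRep.inner_vec, ← r.toInvariantRep.T_vec]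
    refine (norm_inner_le_norm _ _).trans ?_
    rw [LinearIsometryEquiv.norm_map, ← sq]
    exact le_add_of_nonneg_right (by positivity)
  · intro z hz
    have : z = ((z.re : ℝ) : ℂ) + β * Complex.I := by rw [← hz, Complex.re_add_im]
    rw [this, r.state_kms_orbit _ hX, ← zero_add ((z.re : ℝ) : ℂ), ← hX.map]
    have h2 := r.toInvariantRep.inner_vec (star (N.trans (z.re, 0) (X 0))) (star (X 0))
    rw [star_star] at h2
    rw [← h2, ← map_star, ← r.toInvariantRep.T_vec]
    refine (norm_inner_le_norm _ _).trans ?_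
    rw [LinearIsometryEquiv.norm_map, ← sq]
    exact le_add_of_nonneg_left (by positivity)

theorem hasDerivAt_state_orbit (r : ThermalRep N ω β H) (a : A) {Y : ℂ → A}
    (hY : IsEntireOrbit N Y) (s : ℝ) :
    HasDerivAt (fun s : ℝ => ω (a * Y (s * Complex.I)))
      (Complex.I * ω (a * deriv Y (s * Complex.I))) s := by
  have h1 : HasDerivAt (fun z : ℂ => ω (a * Y z)) (ω (a * deriv Y (s * Complex.I)))
      (s * Complex.I) := by
    simp only [← r.toInvariantRep.functional_apply]
    exact r.functional.hasFDerivAt.comp_hasDerivAt _ ((hY.diff _).hasDerivAt.const_mul a)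
  have h2 : HasDerivAt (fun s : ℝ => (s : ℂ) * Complex.I) Complex.I s := by
    simpa using (Complex.ofRealCLM.hasDerivAt (x := s)).mul_const Complex.I
  simpa [Function.comp_def, mul_comm] using h1.comp s h2

/-- The commutator is the integral over imaginary time of the Duhamel pairing of Ċ with X.
Cauchy–Schwarz, in the additive form with parameter `l`, separates the two; the Ċ part integrates
back to a commutator and the X part is bounded on the strip. -/
theorem bogoliubov_entire (r : ThermalRep N ω β H) {C X : ℂ → A} (hC : IsEntireOrbit N C)
    (hCs : ∀ z, star (C ((starRingEnd ℂ) z)) = C z) (hX : IsEntireOrbit N X) {l : ℝ} (hl : 0 < l) :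
    2 * ‖ω (C 0 * X 0) - ω (X 0 * C 0)‖
      ≤ l * ‖ω (C 0 * deriv C 0) - ω (deriv C 0 * C 0)‖
        + l⁻¹ * (β * (‖r.vec (X 0)‖ ^ 2 + ‖r.vec (star (X 0))‖ ^ 2)) := by
  set M := ‖r.vec (X 0)‖ ^ 2 + ‖r.vec (star (X 0))‖ ^ 2
  have hC' := hC.deriv
  have hCs' : star (deriv C 0) = deriv C 0 := by
    have h1 : (star ∘ C ∘ (starRingEnd ℂ)) = C := funext hCs
    have h2 := deriv_star_conj (f := C)
    rw [h1] at h2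
    have h3 := congrFun h2 0
    simpa using h3.symm
  set u : ℝ → H := fun s => r.vec (deriv C ((s / 2 : ℝ) * Complex.I)) with hu
  set v : ℝ → H := fun s => r.vec (X ((s / 2 : ℝ) * Complex.I)) with hv
  have huc : Continuous u := r.vec.continuous.comp (hC'.diff.continuous.comp (by fun_prop))
  have hvc : Continuous v := r.vec.continuous.comp (hX.diff.continuous.comp (by fun_prop))
  have hcont (a : A) {Y : ℂ → A} (hY : IsEntireOrbit N Y) :
      Continuous fun s : ℝ => Complex.I * ω (a * Y (s * Complex.I)) := by
    have := (r.toInvariantRep.differentiable_state_mul (differentiable_const a) hY.diff).continuous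
    exact continuous_const.mul (this.comp (by fun_prop))
  -- The fundamental theorem of calculus along [0, iβ]; KMS identifies the value at iβ with the
  -- opposite operator order.
  have hint1 : ∫ s in (0 : ℝ)..β, Complex.I * ω (C 0 * deriv X (s * Complex.I))
      = ω (X 0 * C 0) - ω (C 0 * X 0) := by
    rw [intervalIntegral.integral_eq_sub_of_hasDerivAt
      (fun s _ => r.hasDerivAt_state_orbit (C 0) hX s) ((hcont _ hX.deriv).intervalIntegrable _ _)]
    have := r.state_kms_orbit (C 0) hX 0
    simp only [Complex.ofReal_zero, zero_add] at this
    rw [this]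
    simp
  have hint2 : ∫ s in (0 : ℝ)..β, Complex.I * ω (deriv C 0 * deriv C (s * Complex.I))
      = ω (C 0 * deriv C 0) - ω (deriv C 0 * C 0) := by
    rw [intervalIntegral.integral_eq_sub_of_hasDerivAt
      (fun s _ => r.hasDerivAt_state_orbit (deriv C 0) hC s) ((hcont _ hC').intervalIntegrable _ _)]
    have := r.state_kms_orbit (deriv C 0) hC 0
    simp only [Complex.ofReal_zero, zero_add] at this
    rw [this]
    simp
  -- Self-adjointness of Ċ(0) makes the integrand a square, so the commutator of C with Ċ computes
  -- ∫‖u‖² exactly.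
  have hu2 (s : ℝ) : ω (deriv C 0 * deriv C (s * Complex.I)) = ((‖u s‖ ^ 2 : ℝ) : ℂ) := by
    have := r.toInvariantRep.state_star_orbit hC' hC' s
    rw [hCs', inner_self_eq_norm_sq_to_K] at this
    rw [this, Complex.ofReal_pow]
    rfl
  have hUint : ∫ s in (0 : ℝ)..β, ‖u s‖ ^ 2 ≤ ‖ω (C 0 * deriv C 0) - ω (deriv C 0 * C 0)‖ := by
    rw [← hint2]
    simp only [hu2]
    rw [intervalIntegral.integral_const_mul, intervalIntegral.integral_ofReal, norm_mul,
      Complex.norm_I, one_mul, Complex.norm_real]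
    exact le_abs_self _
  have hVint : ∫ s in (0 : ℝ)..β, ‖v s‖ ^ 2 ≤ β * M := by
    have := intervalIntegral.integral_mono_on r.β_pos.le
      ((hvc.norm.pow 2).intervalIntegrable (μ := volume) 0 β) intervalIntegrable_const
      (fun s hs => r.norm_vec_orbit_sq_le hX hs.1 hs.2)
    rwa [intervalIntegral.integral_const, sub_zero, smul_eq_mul] at this
  have hpt (s : ℝ) : ‖Complex.I * ω (C 0 * deriv X (s * Complex.I))‖
      ≤ l / 2 * ‖u s‖ ^ 2 + l⁻¹ / 2 * ‖v s‖ ^ 2 := by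
    rw [norm_mul, Complex.norm_I, one_mul, r.toInvariantRep.state_deriv_swap hC hX, norm_neg,
      ← hCs', r.toInvariantRep.state_star_orbit hC' hX]
    refine (norm_inner_le_norm _ _).trans ?_
    change ‖u s‖ * ‖v s‖ ≤ _
    have h1 : l / 2 * ‖u s‖ ^ 2 + l⁻¹ / 2 * ‖v s‖ ^ 2 - ‖u s‖ * ‖v s‖
        = l⁻¹ / 2 * (l * ‖u s‖ - ‖v s‖) ^ 2 := by
      field_simp
      ring
    have h2 : 0 ≤ l⁻¹ / 2 * (l * ‖u s‖ - ‖v s‖) ^ 2 := by positivity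
    linarith
  have hmain : ‖ω (X 0 * C 0) - ω (C 0 * X 0)‖
      ≤ ∫ s in (0 : ℝ)..β, (l / 2 * ‖u s‖ ^ 2 + l⁻¹ / 2 * ‖v s‖ ^ 2) := by
    rw [← hint1]
    exact intervalIntegral.norm_integral_le_of_norm_le r.β_pos.le
      (ae_of_all _ fun s _ => hpt s) (Continuous.intervalIntegrable (by fun_prop) _ _)
  rw [intervalIntegral.integral_add (Continuous.intervalIntegrable (by fun_prop) _ _)
    (Continuous.intervalIntegrable (by fun_prop) _ _), intervalIntegral.integral_const_mul,
    intervalIntegral.integral_const_mul] at hmain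
  rw [norm_sub_rev]
  have h1 := mul_le_mul_of_nonneg_left hUint hl.le
  have h2 := mul_le_mul_of_nonneg_left hVint (inv_pos.2 hl).le
  linarith

/-- The closed real subspace generated by the vectors `c Ω` with `c` self-adjoint. -/
def _root_.ThermalQFT.InvariantRep.selfAdjointVectors (r : InvariantRep N ω H) : Set H :=
  closure {ξ | ∃ c : A, star c = c ∧ ξ = r.vec c}

/-- Bogoliubov's inequality for the KMS state. -/
theorem bogoliubov (r : ThermalRep N ω β H) {ψ ψ' : H} (hψ : ψ ∈ r.selfAdjointVectors)
    (hψ' : HasDerivAt (fun t : ℝ => r.T (t, 0) ψ) ψ' 0) (a : A) {l : ℝ} (hl : 0 < l) :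
    2 * ‖inner ℂ ψ (r.vec a) - inner ℂ (r.vec (star a)) ψ‖
      ≤ l * ‖inner ℂ ψ ψ' - inner ℂ ψ' ψ‖
        + l⁻¹ * (β * (‖r.vec a‖ ^ 2 + ‖r.vec (star a)‖ ^ 2)) := by
  set V := N.timeGroup
  set U := r.timeUnitary
  have hvec (ε : ℝ) (c : A) (z : ℂ) : r.vec (V.regularize ε c z) = U.regularize ε (r.vec c) z :=
    V.map_regularize_of_intertwining U r.vec r.toInvariantRep.vec_timeGroup ε c z
  have hvec' (ε : ℝ) (c : A) :
      r.vec (deriv (V.regularize ε c) 0) = deriv (U.regularize ε (r.vec c)) 0 := by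
    have h1 : HasDerivAt (fun z => r.vec (V.regularize ε c z)) _ 0 :=
      r.vec.hasFDerivAt.comp_hasDerivAt (0 : ℂ) (V.differentiable_regularize ε c 0).hasDerivAt
    simp only [hvec] at h1
    exact h1.deriv.symm
  -- The order of limits matters: at fixed `ε` first pass from cΩ to `ψ`, where regularisation makes
  -- all terms continuous, then move the derivative onto `ψ'`, and only then let `ε` tend to 0.
  have hreg {ε : ℝ} (hε : ε ≠ 0) (c : A) (hc : star c = c) :
      2 * ‖inner ℂ (U.regularize ε (r.vec c) 0) (r.vec (V.regularize ε a 0))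
          - inner ℂ (r.vec (star (V.regularize ε a 0))) (U.regularize ε (r.vec c) 0)‖
        ≤ l * ‖inner ℂ (U.regularize ε (r.vec c) 0) (deriv (U.regularize ε (r.vec c)) 0)
            - inner ℂ (deriv (U.regularize ε (r.vec c)) 0) (U.regularize ε (r.vec c) 0)‖
          + l⁻¹ * (β * (‖r.vec (V.regularize ε a 0)‖ ^ 2
            + ‖r.vec (star (V.regularize ε a 0))‖ ^ 2)) := by
    have hC := IsEntireOrbit.regularize N hε c
    have hCs := IsEntireOrbit.star_regularize N ε hc
    have h := r.bogoliubov_entire hC hCs (IsEntireOrbit.regularize N hε a) hl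
    have hs0 : star (V.regularize ε c 0) = V.regularize ε c 0 := by
      simpa using hCs 0
    have hs1 : star (deriv (V.regularize ε c) 0) = deriv (V.regularize ε c) 0 := by
      have h2 := deriv_star_conj (f := V.regularize ε c)
      rw [show (star ∘ V.regularize ε c ∘ (starRingEnd ℂ)) = V.regularize ε c from funext hCs] at h2
      simpa using (congrFun h2 0).symm
    rw [← hvec, ← hvec', r.inner_vec, r.inner_vec, r.inner_vec, r.inner_vec, hs0, hs1, star_star]
    exact h
  have hregψ {ε : ℝ} (hε : ε ≠ 0) :
      2 * ‖inner ℂ (U.regularize ε ψ 0) (r.vec (V.regularize ε a 0))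
          - inner ℂ (r.vec (star (V.regularize ε a 0))) (U.regularize ε ψ 0)‖
        ≤ l * ‖inner ℂ (U.regularize ε ψ 0) (U.regularize ε ψ' 0)
            - inner ℂ (U.regularize ε ψ' 0) (U.regularize ε ψ 0)‖
          + l⁻¹ * (β * (‖r.vec (V.regularize ε a 0)‖ ^ 2
            + ‖r.vec (star (V.regularize ε a 0))‖ ^ 2)) := by
    rw [← U.deriv_regularize hε hψ']
    have hc0 := U.continuous_regularize ε 0
    have hc1 := U.continuous_deriv_regularize ε
    refine closure_minimal (s := {ξ | ∃ c : A, star c = c ∧ ξ = r.vec c})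
      (t := {ψ | 2 * ‖inner ℂ (U.regularize ε ψ 0) (r.vec (V.regularize ε a 0))
          - inner ℂ (r.vec (star (V.regularize ε a 0))) (U.regularize ε ψ 0)‖
        ≤ l * ‖inner ℂ (U.regularize ε ψ 0) (deriv (U.regularize ε ψ) 0)
            - inner ℂ (deriv (U.regularize ε ψ) 0) (U.regularize ε ψ 0)‖
          + l⁻¹ * (β * (‖r.vec (V.regularize ε a 0)‖ ^ 2
            + ‖r.vec (star (V.regularize ε a 0))‖ ^ 2))}) ?_ ?_ hψ
    · rintro _ ⟨c, hc, rfl⟩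
      exact hreg hε c hc
    · exact isClosed_le (by fun_prop) (by fun_prop)
  have hta := (V.tendsto_regularize a).mono_left (nhdsWithin_le_nhds (s := {0}ᶜ))
  have htψ := (U.tendsto_regularize ψ).mono_left (nhdsWithin_le_nhds (s := {0}ᶜ))
  have htψ' := (U.tendsto_regularize ψ').mono_left (nhdsWithin_le_nhds (s := {0}ᶜ))
  have hva := (r.vec.continuous.tendsto a).comp hta
  have hvsa := (r.vec.continuous.tendsto (star a)).comp hta.star
  refine le_of_tendsto_of_tendsto
    (((htψ.inner hva).sub (hvsa.inner htψ)).norm.const_mul 2)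
    ((((htψ.inner htψ').sub (htψ'.inner htψ)).norm.const_mul l).add
      (((hva.norm.pow 2).add (hvsa.norm.pow 2)).const_mul β |>.const_mul l⁻¹)) ?_
  filter_upwards [self_mem_nhdsWithin] with ε hε
  exact hregψ hε

end ThermalRep

end Net

/-! ### Operators affiliated with a von Neumann algebra -/

section Hilbert

variable {H : Type*} [NormedAddCommGroup H] [InnerProductSpace ℂ H]

/-- The Hilbert space `H ⊕ H`. -/
abbrev Double (H : Type*) : Type _ := WithLp 2 (H × H)

/-- The diagonal operator `b ⊕ b`. -/
def diag (b : H →L[ℂ] H) : Double H →L[ℂ] Double H :=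
  ((WithLp.prodContinuousLinearEquiv 2 ℂ H H).symm : H × H →L[ℂ] Double H) ∘L
    (b.prodMap b) ∘L ((WithLp.prodContinuousLinearEquiv 2 ℂ H H) : Double H →L[ℂ] H × H)

/-- The pair `(ξ, η)` as an element of `H ⊕ H`. -/
def pair : H × H →L[ℂ] Double H := (WithLp.prodContinuousLinearEquiv 2 ℂ H H).symm

/-- The components of an element of `H ⊕ H`. -/
def unpair : Double H →L[ℂ] H × H := (WithLp.prodContinuousLinearEquiv 2 ℂ H H)

@[simp] theorem unpair_pair (x : H × H) : unpair (pair x) = x := rfl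

@[simp] theorem pair_unpair (p : Double H) : pair (unpair p) = p := rfl

theorem diag_apply (b : H →L[ℂ] H) (p : Double H) :
    diag b p = pair (b (unpair p).1, b (unpair p).2) := rfl

theorem inner_pair (x y : H × H) :
    inner ℂ (pair x) (pair y) = inner ℂ x.1 y.1 + inner ℂ x.2 y.2 := by
  rw [WithLp.prod_inner_apply]
  rfl

theorem norm_pair_sq (x : H × H) : ‖pair x‖ ^ 2 = ‖x.1‖ ^ 2 + ‖x.2‖ ^ 2 :=
  WithLp.prod_norm_sq_eq_of_L2 _

/-- The projection onto a subspace commutes with an operator that leaves the subspace invariant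
together with its adjoint. -/
theorem starProjection_comm {E : Type*} [NormedAddCommGroup E] [InnerProductSpace ℂ E]
    (K : Submodule ℂ E) [K.HasOrthogonalProjection] (b b' : E →L[ℂ] E)
    (hadj : ∀ x y, inner ℂ (b' x) y = inner ℂ x (b y)) (hb : ∀ x ∈ K, b x ∈ K)
    (hb' : ∀ x ∈ K, b' x ∈ K) (x : E) : K.starProjection (b x) = b (K.starProjection x) := by
  refine Submodule.eq_starProjection_of_mem_orthogonal (hb _ (Submodule.starProjection_apply_mem K x)) ?_
  rw [← map_sub, Submodule.mem_orthogonal]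
  intro y hy
  rw [← hadj]
  exact (Submodule.mem_orthogonal _ _).1 (Submodule.sub_starProjection_mem_orthogonal x) _ (hb' y hy)

variable (Q : Double H →L[ℂ] Double H)

/-- The four matrix entries of an operator on `H ⊕ H`. -/
def entry (i j : Bool) : H →L[ℂ] H :=
  (if i then ContinuousLinearMap.snd ℂ H H else ContinuousLinearMap.fst ℂ H H) ∘L unpair ∘L Q ∘L
    pair ∘L (if j then ContinuousLinearMap.inr ℂ H H else ContinuousLinearMap.inl ℂ H H)

theorem apply_pair_eq_entry (x y : H) :
    Q (pair (x, y)) = pair (entry Q false false x + entry Q false true y,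
      entry Q true false x + entry Q true true y) := by
  have h : pair (x, y) = pair (x, 0) + pair (0, y) := by
    rw [← map_add]
    simp
  rw [h, map_add, ← pair_unpair (Q (pair (x, 0)) + Q (pair (0, y))), map_add]
  rfl

/-- Commuting with b ⊕ b means that each matrix entry commutes with `b`. This reduces questions on H
⊕ H to commutants on H. -/
theorem entry_comm {b : H →L[ℂ] H} (h : ∀ p, Q (diag b p) = diag b (Q p)) (i j : Bool) :
    b * entry Q i j = entry Q i j * b := by
  ext x
  have h0 := h (pair (x, 0))
  have h1 := h (pair (0, x))
  rw [diag_apply, diag_apply] at h0 h1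
  simp only [unpair_pair, map_zero] at h0 h1
  cases i <;> cases j <;> simp [entry, mul_apply_eq_comp, h0, h1]

/-- An operator on `H ⊕ H` that commutes with all `b ⊕ b`, `b ∈ S`, commutes with all `t ⊕ t`,
`t ∈ S''`. -/
theorem comm_diag_of_mem_bicommutant {S : Set (H →L[ℂ] H)}
    (hQ : ∀ b ∈ S, ∀ p, Q (diag b p) = diag b (Q p)) {t : H →L[ℂ] H}
    (ht : t ∈ Set.centralizer (Set.centralizer S)) (p : Double H) :
    Q (diag t p) = diag t (Q p) := by
  have hmem (i j : Bool) (x : H) : entry Q i j (t x) = t (entry Q i j x) := by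
    have := ht (entry Q i j) fun b hb => entry_comm Q (hQ b hb) i j
    exact congrArg (fun f : H →L[ℂ] H => f x) this
  obtain ⟨x, rfl⟩ : ∃ x, p = pair x := ⟨unpair p, rfl⟩
  obtain ⟨x, y⟩ := x
  rw [diag_apply, unpair_pair, apply_pair_eq_entry, apply_pair_eq_entry, diag_apply]
  simp [hmem]

theorem diag_adjoint [CompleteSpace H] (b : H →L[ℂ] H) (x y : Double H) :
    inner ℂ (diag (star b) x) y = inner ℂ x (diag b y) := by
  obtain ⟨x, rfl⟩ : ∃ x', x = pair x' := ⟨unpair x, rfl⟩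
  obtain ⟨y, rfl⟩ : ∃ y', y = pair y' := ⟨unpair y, rfl⟩
  rw [diag_apply, diag_apply, inner_pair, inner_pair]
  simp [ContinuousLinearMap.star_eq_adjoint, ContinuousLinearMap.adjoint_inner_left]

/-- The graph of `m⁻¹ S` in `H ⊕ H`. -/
def scaledGraph (S : H →ₗ.[ℂ] H) (m : ℂ) : Submodule ℂ (Double H) :=
  S.graph.comap (((LinearMap.id).prodMap (m • LinearMap.id)).comp
    (unpair : Double H →L[ℂ] H × H).toLinearMap)

theorem mem_scaledGraph {S : H →ₗ.[ℂ] H} {m : ℂ} {x : H × H} :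
    pair x ∈ scaledGraph S m ↔ ∃ u : S.domain, (u : H) = x.1 ∧ S u = m • x.2 := by
  rw [scaledGraph, Submodule.mem_comap, LinearPMap.mem_graph_iff]
  rfl

theorem isClosed_scaledGraph {S : H →ₗ.[ℂ] H} (hS : S.IsClosed) (m : ℂ) :
    IsClosed (scaledGraph S m : Set (Double H)) := by
  have : Continuous fun p : Double H => ((unpair p).1, m • (unpair p).2) := by fun_prop
  exact IsClosed.preimage this hS

variable [CompleteSpace H]

instance {S : H →ₗ.[ℂ] H} {m : ℂ} [h : Fact S.IsClosed] :
    (scaledGraph S m).HasOrthogonalProjection := by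
  have := (isClosed_scaledGraph h.out m).completeSpace_coe
  exact Submodule.HasOrthogonalProjection.ofCompleteSpace _

/-- Bounded approximants of `S`: for self-adjoint `S` this is `S (1 + S² / m²)⁻¹`. -/
def boundedApprox (S : H →ₗ.[ℂ] H) [Fact S.IsClosed] (m : ℂ) : H →L[ℂ] H :=
  m • entry (scaledGraph S m).starProjection true false

/-- The bounded resolvent-like operator, for self-adjoint `S` equal to `(1 + S² / m²)⁻¹`. -/
def boundedResolvent (S : H →ₗ.[ℂ] H) [Fact S.IsClosed] (m : ℂ) : H →L[ℂ] H :=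
  entry (scaledGraph S m).starProjection false false

variable (S : H →ₗ.[ℂ] H) [Fact S.IsClosed]

theorem starProjection_scaledGraph (m : ℂ) (ξ : H) :
    (scaledGraph S m).starProjection (pair (ξ, 0))
      = pair (boundedResolvent S m ξ, entry (scaledGraph S m).starProjection true false ξ) := by
  rw [apply_pair_eq_entry]
  simp [boundedResolvent]

theorem boundedResolvent_mem (m : ℂ) (ξ : H) : ∃ u : S.domain,
    (u : H) = boundedResolvent S m ξ ∧ S u = boundedApprox S m ξ := by
  have := Submodule.starProjection_apply_mem (scaledGraph S m) (pair (ξ, 0))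
  rw [starProjection_scaledGraph, mem_scaledGraph] at this
  exact this

/-- The projection of (ξ, 0) is the point of the graph of m⁻¹S closest to it; comparison with the
graph point over `x` gives the inequality. It yields both the uniform bound and the convergence
below, without spectral theory. -/
theorem boundedApprox_estimate {m : ℝ} (hm : 0 < m) (ξ : H) (x : S.domain) :
    ‖ξ - boundedResolvent S m ξ‖ ^ 2 + (m⁻¹ * ‖boundedApprox S m ξ‖) ^ 2
      ≤ ‖ξ - x‖ ^ 2 + (m⁻¹ * ‖S x‖) ^ 2 := by
  have hm' : (m : ℂ) ≠ 0 := by exact_mod_cast hm.ne'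
  have hx : pair ((x : H), (m : ℂ)⁻¹ • S x) ∈ scaledGraph S m :=
    mem_scaledGraph.2 ⟨x, rfl, by simp [smul_smul, hm']⟩
  have h1 := Submodule.starProjection_minimal (U := scaledGraph S m) (pair (ξ, (0 : H)))
  have h2 : ‖pair (ξ, 0) - (scaledGraph S m).starProjection (pair (ξ, 0))‖
      ≤ ‖pair (ξ, 0) - pair ((x : H), (m : ℂ)⁻¹ • S x)‖ := by
    rw [h1]
    exact ciInf_le ⟨0, by rintro _ ⟨y, rfl⟩; positivity⟩
      (⟨_, hx⟩ : scaledGraph S m)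
  have h3 := pow_le_pow_left₀ (norm_nonneg _) h2 2
  rw [starProjection_scaledGraph, ← map_sub, ← map_sub, norm_pair_sq, norm_pair_sq] at h3
  simp only [Prod.fst_sub, Prod.snd_sub, zero_sub, norm_neg] at h3
  rw [norm_smul, norm_inv, Complex.norm_real, Real.norm_of_nonneg hm.le] at h3
  have h4 : m⁻¹ * ‖boundedApprox S m ξ‖ = ‖entry (scaledGraph S m).starProjection true false ξ‖ := by
    rw [boundedApprox, smul_apply, norm_smul, Complex.norm_real,
      Real.norm_of_nonneg hm.le, inv_mul_cancel_left₀ hm.ne']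
  rw [h4]
  exact h3

theorem norm_boundedApprox_le {m : ℝ} (hm : 0 < m) (x : S.domain) :
    ‖boundedApprox S m x‖ ≤ ‖S x‖ := by
  have h := boundedApprox_estimate S hm x x
  rw [sub_self, norm_zero] at h
  have h1 : (m⁻¹ * ‖boundedApprox S m x‖) ^ 2 ≤ (m⁻¹ * ‖S x‖) ^ 2 := by nlinarith
  have h2 := (pow_le_pow_iff_left₀ (by positivity) (by positivity) two_ne_zero).1 h1
  exact le_of_mul_le_mul_left h2 (inv_pos.2 hm)

theorem tendsto_boundedResolvent (hd : Dense (S.domain : Set H)) (ξ : H) :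
    Tendsto (fun m : ℝ => boundedResolvent S m ξ) atTop (𝓝 ξ) := by
  rw [Metric.tendsto_nhds]
  intro ε hε
  obtain ⟨x, hx, hxε⟩ := Metric.mem_closure_iff.1 (hd ξ) (ε / 2) (by positivity)
  set x' : S.domain := ⟨x, hx⟩
  have hlim : Tendsto (fun m : ℝ => m⁻¹ * ‖S x'‖) atTop (𝓝 0) := by
    simpa using tendsto_inv_atTop_zero.mul_const ‖S x'‖
  filter_upwards [eventually_gt_atTop 0, hlim.eventually_lt_const (show 0 < ε / 2 by positivity)]
    with m hm hmε
  have h := boundedApprox_estimate S hm ξ x'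
  rw [dist_comm, dist_eq_norm]
  rw [dist_eq_norm] at hxε
  refine lt_of_pow_lt_pow_left₀ 2 hε.le ?_
  have h1 : ‖ξ - (x' : H)‖ ^ 2 < (ε / 2) ^ 2 := pow_lt_pow_left₀ hxε (norm_nonneg _) two_ne_zero
  have h2 : (m⁻¹ * ‖S x'‖) ^ 2 < (ε / 2) ^ 2 := pow_lt_pow_left₀ hmε (by positivity) two_ne_zero
  nlinarith [sq_nonneg (m⁻¹ * ‖boundedApprox S m ξ‖)]

/-- Against `y` in the domain, symmetry moves `S` onto `y` and leaves the resolvent, which tends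
strongly to the identity. The bound ‖S_m x‖ ≤ ‖Sx‖ extends this to every `η` by density. -/
theorem tendsto_inner_boundedApprox (hd : Dense (S.domain : Set H))
    (hsym : ∀ x y : S.domain, inner ℂ (S x) (y : H) = inner ℂ (x : H) (S y)) (x : S.domain) (η : H) :
    Tendsto (fun m : ℝ => inner ℂ η (boundedApprox S m x)) atTop (𝓝 (inner ℂ η (S x))) := by
  have hdom (y : S.domain) :
      Tendsto (fun m : ℝ => inner ℂ (y : H) (boundedApprox S m x)) atTop (𝓝 (inner ℂ (y : H) (S x))) := by
    rw [← hsym]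
    have h : Tendsto (fun m : ℝ => inner ℂ (S y) (boundedResolvent S m (x : H))) atTop
        (𝓝 (inner ℂ (S y) (x : H))) :=
      tendsto_const_nhds.inner (tendsto_boundedResolvent S hd x)
    refine h.congr fun m => ?_
    obtain ⟨u, hu, hSu⟩ := boundedResolvent_mem S m (x : H)
    rw [← hu, ← hSu, hsym]
  rw [Metric.tendsto_nhds]
  intro ε hε
  obtain ⟨y, hy, hyε⟩ := Metric.mem_closure_iff.1 (hd η) (ε / (4 * (‖S x‖ + 1))) (by positivity)
  filter_upwards [eventually_gt_atTop 0, (Metric.tendsto_nhds.1 (hdom ⟨y, hy⟩)) (ε / 2) (by positivity)]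
    with m hm hmε
  rw [dist_eq_norm, ← inner_sub_right] at hmε ⊢
  have hsplit : inner ℂ η (boundedApprox S m x - S x)
      = inner ℂ (η - y) (boundedApprox S m x - S x) + inner ℂ y (boundedApprox S m x - S x) := by
    rw [inner_sub_left, sub_add_cancel]
  rw [hsplit]
  rw [dist_eq_norm] at hyε
  have h1 : ‖boundedApprox S m x - S x‖ ≤ 2 * ‖S x‖ :=
    (norm_sub_le _ _).trans (by linarith [norm_boundedApprox_le S hm x])
  have h2 : ‖inner ℂ (η - y) (boundedApprox S m x - S x)‖ ≤ ε / 2 := by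
    refine (norm_inner_le_norm _ _).trans ?_
    calc ‖η - y‖ * ‖boundedApprox S m x - S x‖
        ≤ (ε / (4 * (‖S x‖ + 1))) * (2 * (‖S x‖ + 1)) :=
          mul_le_mul hyε.le (by linarith) (norm_nonneg _) (by positivity)
      _ = ε / 2 := by
          have : ‖S x‖ + 1 ≠ 0 := by positivity
          field_simp
          norm_num
  exact (norm_add_le _ _).trans_lt (by
    have : ‖inner ℂ y (boundedApprox S m x - S x)‖ < ε / 2 := hmε
    linarith)

/-- Affiliation says that b ⊕ b preserves the graph for every `b` in the commutant. The commutant is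
closed under adjoints, so the graph projection commutes with b ⊕ b, and hence so do its entries with
`b`. -/
theorem boundedApprox_mem_bicommutant {M : Set (H →L[ℂ] H)} (hM : ∀ b ∈ M, star b ∈ M)
    (haff : Affiliated S (Set.centralizer (Set.centralizer M))) (m : ℂ) :
    boundedApprox S m ∈ Set.centralizer (Set.centralizer M) := by
  have hstar : ∀ b ∈ Set.centralizer M, star b ∈ Set.centralizer M := by
    intro b hb c hc
    have := hb (star c) (hM c hc)
    simpa using (congrArg star this).symm
  have hinv : ∀ b ∈ Set.centralizer M, ∀ p ∈ scaledGraph S m, diag b p ∈ scaledGraph S m := by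
    intro b hb p hp
    obtain ⟨x, rfl⟩ : ∃ x, p = pair x := ⟨unpair p, rfl⟩
    obtain ⟨u, hu, hSu⟩ := mem_scaledGraph.1 hp
    obtain ⟨h, hb'⟩ := haff.2 b (Set.subset_centralizer_centralizer hb) u
    rw [diag_apply, unpair_pair, mem_scaledGraph]
    exact ⟨⟨b u, h⟩, by rw [← hu], by rw [hb', hSu, map_smul]⟩
  intro b hb
  have h := entry_comm (scaledGraph S m).starProjection (b := b) (fun p =>
    starProjection_comm _ (diag b) (diag (star b)) (diag_adjoint b) (hinv b hb)
      (hinv _ (hstar b hb)) p) true false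
  rw [boundedApprox, mul_smul_comm, smul_mul_assoc, h]

end Hilbert

section Net

variable {A : Type*} [CStarAlgebra A] [PartialOrder A] [StarOrderedRing A]
variable {H : Type*} [NormedAddCommGroup H] [InnerProductSpace ℂ H] [CompleteSpace H]
variable {N : LocalNet A} {ω : A →ₚ[ℂ] ℂ}

namespace InvariantRep

variable (r : InvariantRep N ω H)

/-- Simultaneous strong approximation of an element of the bicommutant on two vectors. -/
theorem pair_bicommutant_mem_closure {t : H →L[ℂ] H}
    (ht : t ∈ Set.centralizer (Set.centralizer (Set.range r.π))) (ξ η : H) :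
    pair (t ξ, t η) ∈ closure (Set.range fun a : A => pair (r.π a ξ, r.π a η)) := by
  let L : A →ₗ[ℂ] Double H :=
    { toFun := fun a => pair (r.π a ξ, r.π a η)
      map_add' := fun a b => by
        rw [← map_add pair]
        simp
      map_smul' := fun c a => by
        rw [RingHom.id_apply, ← map_smul pair]
        simp }
  let K : Submodule ℂ (Double H) := (LinearMap.range L).topologicalClosure
  have : CompleteSpace K := (Submodule.isClosed_topologicalClosure _).completeSpace_coe
  have hinv (a : A) : ∀ p ∈ K, diag (r.π a) p ∈ K := by
    intro p hp
    have hmaps : Set.MapsTo (diag (r.π a)) (LinearMap.range L : Set (Double H))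
        (LinearMap.range L : Set (Double H)) := by
      rintro _ ⟨b, rfl⟩
      exact ⟨a * b, by simp [L, diag_apply]⟩
    exact hmaps.closure (diag (r.π a)).continuous hp
  have hcomm : ∀ b ∈ Set.range r.π, ∀ p, K.starProjection (diag b p) = diag b (K.starProjection p) := by
    rintro _ ⟨a, rfl⟩ p
    refine starProjection_comm K (diag (r.π a)) (diag (star (r.π a))) (diag_adjoint _) (hinv a) ?_ p
    rw [← map_star]
    exact hinv (star a)
  -- Von Neumann's density argument: K contains (ξ, η) because the algebra is unital, and t ⊕ t
  -- commutes with the projection onto K.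
  have h1 : pair (ξ, η) ∈ K := Submodule.le_topologicalClosure _ ⟨1, by simp [L]⟩
  have h2 := comm_diag_of_mem_bicommutant K.starProjection hcomm ht (pair (ξ, η))
  rw [Submodule.starProjection_eq_self_iff.2 h1, diag_apply, unpair_pair] at h2
  have h3 : pair (t ξ, t η) ∈ K := h2 ▸ Submodule.starProjection_apply_mem K _
  exact h3

/-- For self-adjoint `c` this expression is twice a real part. Unlike the real part it is complex
linear in the operator, so it extends to all of the algebra and then to the bicommutant by
approximation on the two vectors Ω and `η`; the approximants of `t` need not be self-adjoint. -/
theorem inner_add_inner_eq_zero {η : H} (hη : ∀ c : A, star c = c → (inner ℂ η (r.vec c)).re = 0)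
    {t : H →L[ℂ] H} (ht : t ∈ Set.centralizer (Set.centralizer (Set.range r.π))) :
    inner ℂ η (t r.Ω) + inner ℂ r.Ω (t η) = 0 := by
  have hsa (c : A) (hc : star c = c) : inner ℂ η (r.π c r.Ω) + inner ℂ r.Ω (r.π c η) = 0 := by
    have h1 : inner ℂ r.Ω (r.π c η) = inner ℂ (r.π c r.Ω) η := by
      rw [← ContinuousLinearMap.adjoint_inner_left, ← ContinuousLinearMap.star_eq_adjoint,
        ← map_star, hc]
    rw [h1, ← inner_conj_symm (r.π c r.Ω) η, Complex.add_conj, ← vec_apply, hη c hc]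
    simp
  have hall (a : A) : inner ℂ η (r.π a r.Ω) + inner ℂ r.Ω (r.π a η) = 0 := by
    have h1 := hsa (realPart a) (realPart a).2
    have h2 := hsa (imaginaryPart a) (imaginaryPart a).2
    rw [← realPart_add_I_smul_imaginaryPart a]
    simp only [map_add, map_smul, add_apply, smul_apply,
      inner_add_right, inner_smul_right]
    linear_combination h1 + Complex.I * h2
  have hc : Continuous fun p : Double H => inner ℂ η (unpair p).1 + inner ℂ r.Ω (unpair p).2 := by
    fun_prop
  have := closure_minimal (t := {p : Double H | inner ℂ η (unpair p).1 + inner ℂ r.Ω (unpair p).2 = 0})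
    (by rintro _ ⟨a, rfl⟩; exact hall a) (isClosed_eq hc continuous_const)
    (r.pair_bicommutant_mem_closure ht r.Ω η)
  exact this

/-- A vector orthogonal to everything that is orthogonal to a real subspace lies in its closure. -/
theorem _root_.ThermalQFT.mem_closure_of_orthogonal {E : Type*} [NormedAddCommGroup E]
    [InnerProductSpace ℝ E] [CompleteSpace E] (s : Set E) (hadd : ∀ x ∈ s, ∀ y ∈ s, x + y ∈ s)
    (hzero : (0 : E) ∈ s) (hsmul : ∀ (c : ℝ), ∀ x ∈ s, c • x ∈ s) {x : E}
    (h : ∀ η, (∀ ξ ∈ s, inner ℝ η ξ = 0) → inner ℝ η x = 0) : x ∈ closure s := by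
  let K : Submodule ℝ E :=
    { carrier := s
      add_mem' := fun hx hy => hadd _ hx _ hy
      zero_mem' := hzero
      smul_mem' := fun c _ hx => hsmul c _ hx }
  have hK : x ∈ K.topologicalClosure := by
    rw [← Submodule.orthogonal_orthogonal_eq_closure, Submodule.mem_orthogonal]
    exact fun η hη => h η ((Submodule.mem_orthogonal' _ _).1 hη)
  exact hK

/-- A self-adjoint operator affiliated with a local algebra maps `Ω` into the closure of the
vectors `c Ω` with `c` self-adjoint. -/
theorem apply_Ω_mem_selfAdjointVectors {S : H →ₗ.[ℂ] H} (hS : IsSelfAdjoint S) {O : Region}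
    (haff : Affiliated S (r.localVN O)) (hΩ : r.Ω ∈ S.domain) :
    S ⟨r.Ω, hΩ⟩ ∈ r.selfAdjointVectors := by
  have hd : Dense (S.domain : Set H) := hS.dense_domain
  have hsym : ∀ x y : S.domain, inner ℂ (S x) (y : H) = inner ℂ (x : H) (S y) := by
    have h := LinearPMap.adjoint_isFormalAdjoint hd
    rw [LinearPMap.isSelfAdjoint_def.1 hS] at h
    exact fun x y => h x y
  have : Fact S.IsClosed := ⟨haff.1⟩
  let : InnerProductSpace ℝ H := InnerProductSpace.rclikeToReal ℂ H
  refine mem_closure_of_orthogonal {ξ | ∃ c : A, star c = c ∧ ξ = r.vec c} ?_ ⟨0, star_zero _, by rw [map_zero]⟩ ?_ fun η hη => ?_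
  · rintro _ ⟨c, hc, rfl⟩ _ ⟨d, hd, rfl⟩
    exact ⟨c + d, by rw [star_add, hc, hd], by rw [map_add]⟩
  · rintro s _ ⟨c, hc, rfl⟩
    exact ⟨(s : ℂ) • c, by simp [star_smul, hc], (map_smul r.vec (s : ℂ) c).symm⟩
  · have hη' : ∀ c : A, star c = c → (inner ℂ η (r.vec c)).re = 0 := by
      intro c hc
      have := hη (r.vec c) ⟨c, hc, rfl⟩
      rw [real_inner_eq_re_inner ℂ] at this
      exact this
    have hrel (m : ℝ) : inner ℂ η (boundedApprox S m r.Ω) + inner ℂ r.Ω (boundedApprox S m η) = 0 := by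
      refine r.inner_add_inner_eq_zero hη' ?_
      refine Set.centralizer_subset (Set.centralizer_subset (Set.image_subset_range _ (N.alg O : Set A)))
        (boundedApprox_mem_bicommutant S ?_ haff m)
      rintro _ ⟨a, ha, rfl⟩
      exact ⟨star a, star_mem ha, map_star _ _⟩
    have hlim1 := tendsto_inner_boundedApprox S hd hsym ⟨r.Ω, hΩ⟩ η
    -- Here `η` need not lie in the domain: S_m η is S applied to the resolvent vector, and S moves
    -- onto Ω.
    have hlim2 : Tendsto (fun m : ℝ => inner ℂ r.Ω (boundedApprox S m η)) atTop
        (𝓝 (inner ℂ (S ⟨r.Ω, hΩ⟩) η)) := by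
      have h : Tendsto (fun m : ℝ => inner ℂ (S ⟨r.Ω, hΩ⟩) (boundedResolvent S m η)) atTop
          (𝓝 (inner ℂ (S ⟨r.Ω, hΩ⟩) η)) :=
        tendsto_const_nhds.inner (tendsto_boundedResolvent S hd η)
      refine h.congr fun m => ?_
      obtain ⟨u, hu, hSu⟩ := boundedResolvent_mem S m η
      rw [← hu, ← hSu, hsym]
    have hzero := tendsto_nhds_unique (hlim1.add hlim2)
      (tendsto_const_nhds.congr fun m => (hrel m).symm)
    rw [← inner_conj_symm (S ⟨r.Ω, hΩ⟩) η, Complex.add_conj] at hzero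
    rw [real_inner_eq_re_inner ℂ]
    have h2 : 2 * (inner ℂ η (S ⟨r.Ω, hΩ⟩)).re = 0 := by exact_mod_cast hzero
    change (inner ℂ η (S ⟨r.Ω, hΩ⟩)).re = 0
    linarith

end InvariantRep

end Net

/-! ### Translations of test functions -/

theorem translate_apply (a : Spacetime) (f : TestFn) (x : Spacetime) :
    translate a f x = f (x - a) := rfl

theorem pderiv_apply (μ : Fin 4) (f : TestFn) (x : Spacetime) :
    pderiv μ f x = fderiv ℝ f x (dir μ) := by
  have h := TestFunction.fderivCLM_apply_of_le (𝕜 := ℝ) (n := ⊤) (k := ⊤) f le_top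
  exact congrArg (fun g : Spacetime → Spacetime →L[ℝ] ℝ => g x (dir μ)) h

theorem pderiv_translate (μ : Fin 4) (a : Spacetime) (f : TestFn) :
    pderiv μ (translate a f) = translate a (pderiv μ f) := by
  ext x
  rw [translate_apply, pderiv_apply, pderiv_apply]
  have : (translate a f : Spacetime → ℝ) = fun x => f (x - a) := rfl
  rw [this, fderiv_comp_sub]

theorem translate_translate (a b : Spacetime) (f : TestFn) :
    translate a (translate b f) = translate (a + b) f := by
  ext x
  simp only [translate_apply]
  congr 1
  abel

/-- The difference quotients of a smooth compactly supported function along `e` converge to the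
directional derivative uniformly, together with all derivatives. -/
theorem exists_iteratedFDeriv_diffQuotient_le.{u} {E : Type u} [NormedAddCommGroup E]
    [NormedSpace ℝ E]
    (e : E) (i : ℕ) : ∀ {F : Type u} [NormedAddCommGroup F] [NormedSpace ℝ F] (h : E → F),
    ContDiff ℝ (⊤ : ℕ∞) h → HasCompactSupport h → ∃ C, 0 ≤ C ∧ ∀ t : ℝ, t ≠ 0 → ∀ x,
      ‖iteratedFDeriv ℝ i (fun x => t⁻¹ • (h (x - t • e) - h x) + fderiv ℝ h x e) x‖ ≤ C * |t| := by
  induction i with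
  | zero =>
    intro F _ _ h hh hc
    have hd : ContDiff ℝ (⊤ : ℕ∞) (fderiv ℝ h) := hh.fderiv_right (by simp)
    obtain ⟨C, hC⟩ := ContDiff.lipschitzWith_of_hasCompactSupport (hc.fderiv ℝ) hd (by simp)
    refine ⟨C * ‖e‖ ^ 2, by positivity, fun t ht x => ?_⟩
    rw [norm_iteratedFDeriv_zero]
    have h1 := Convex.norm_image_sub_le_of_norm_fderiv_le' (𝕜 := ℝ) (f := h)
      (s := Metric.closedBall x (|t| * ‖e‖)) (φ := fderiv ℝ h x) (C := C * (|t| * ‖e‖))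
      (x := x) (y := x - t • e)
      (fun y _ => (hh.differentiable (by simp)).differentiableAt)
      (fun y hy => by
        rw [← dist_eq_norm]
        refine (hC.dist_le_mul y x).trans ?_
        gcongr
        exact hy) (convex_closedBall _ _) (Metric.mem_closedBall_self (by positivity))
      (by simp [norm_smul])
    have h2 : t⁻¹ • (h (x - t • e) - h x) + fderiv ℝ h x e
        = t⁻¹ • (h (x - t • e) - h x - fderiv ℝ h x (x - t • e - x)) := by
      rw [sub_sub_cancel_left, map_neg, map_smul, sub_neg_eq_add, smul_add, smul_smul,
        inv_mul_cancel₀ ht, one_smul]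
    rw [h2, norm_smul, norm_inv, Real.norm_eq_abs]
    have ht' : 0 < |t| := abs_pos.2 ht
    rw [sub_sub_cancel_left, norm_neg, norm_smul, Real.norm_eq_abs] at h1
    calc |t|⁻¹ * ‖h (x - t • e) - h x - fderiv ℝ h x (x - t • e - x)‖
        ≤ |t|⁻¹ * (C * (|t| * ‖e‖) * (|t| * ‖e‖)) := by
          gcongr
          simpa using h1
      _ = C * ‖e‖ ^ 2 * |t| := by field_simp
  | succ i ih =>
    intro F _ _ h hh hc
    have hd : ContDiff ℝ (⊤ : ℕ∞) (fderiv ℝ h) := hh.fderiv_right (by simp)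
    obtain ⟨C, hC0, hC⟩ := ih (fderiv ℝ h) hd (hc.fderiv ℝ)
    refine ⟨C, hC0, fun t ht x => ?_⟩
    rw [← norm_iteratedFDeriv_fderiv]
    refine le_of_eq_of_le ?_ (hC t ht x)
    congr 2
    funext y
    have hdiff := hh.differentiable (by simp : ((⊤ : ℕ∞) : WithTop ℕ∞) ≠ 0)
    have hddiff := hd.differentiable (by simp : ((⊤ : ℕ∞) : WithTop ℕ∞) ≠ 0)
    have h1 : HasFDerivAt (fun y => h (y - t • e)) (fderiv ℝ h (y - t • e)) y := by
      have := (hdiff (y - t • e)).hasFDerivAt.comp y ((hasFDerivAt_id y).sub_const (t • e))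
      simpa [Function.comp_def] using this
    have h2 : HasFDerivAt (fun y => fderiv ℝ h y e) ((fderiv ℝ (fderiv ℝ h) y).flip e) y := by
      have := (hddiff y).hasFDerivAt.clm_apply (hasFDerivAt_const e y)
      simpa using this
    have h3 := ((h1.sub (hdiff y).hasFDerivAt).const_smul t⁻¹).add h2
    -- Symmetry of the second derivative: the differential of the remainder of `h` is the remainder
    -- of `fderiv ℝ h`, which closes the induction.
    have h4 : (fderiv ℝ (fderiv ℝ h) y).flip e = fderiv ℝ (fderiv ℝ h) y e := by
      ext v
      exact (hh.contDiffAt.isSymmSndFDerivAt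
        (by rw [minSmoothness_of_isRCLikeNormedField]; exact WithTop.coe_le_coe.2 (show (2 : ℕ∞) ≤ ⊤ from le_top))) v e
    rw [h4] at h3
    exact h3.fderiv

/-- For |t| ≤ 1 all remainders are supported in one compact thickening of the support of f, so
uniform convergence of all derivatives there suffices for the test function topology. -/
theorem tendsto_translate_diffQuotient (f : TestFn) :
    Tendsto (fun t : ℝ => t⁻¹ • (translate (t • dir 0) f - f)) (𝓝[≠] 0) (𝓝 (-pderiv 0 f)) := by
  set e := dir 0
  let K : Compacts Spacetime :=
    ⟨Metric.cthickening ‖e‖ (tsupport f), f.hasCompactSupport.isCompact.cthickening⟩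
  have hKf : tsupport f ⊆ K := Metric.self_subset_cthickening _
  let φ : ℝ → Spacetime → ℝ := fun t x => t⁻¹ • (f (x - t • e) - f x) + fderiv ℝ f x e
  have hφ (t : ℝ) : ContDiff ℝ (⊤ : ℕ∞) (φ t) := by
    have h1 : ContDiff ℝ (⊤ : ℕ∞) (fderiv ℝ f) := f.contDiff.fderiv_right (by simp)
    have h2 : ContDiff ℝ (⊤ : ℕ∞) fun x => f (x - t • e) :=
      f.contDiff.comp (contDiff_id.sub contDiff_const)
    exact ((h2.sub f.contDiff).const_smul _).add (h1.clm_apply contDiff_const)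
  have hsupp (t : ℝ) (ht : |t| ≤ 1) : Function.support (φ t) ⊆ K := by
    intro x hx
    by_contra hxK
    have h1 : x ∉ tsupport f := fun h => hxK (hKf h)
    have h2 : x - t • e ∉ tsupport f := by
      intro h
      refine hxK (Metric.mem_cthickening_of_dist_le x _ _ _ h ?_)
      rw [dist_eq_norm, sub_sub_cancel, norm_smul, Real.norm_eq_abs]
      exact mul_le_of_le_one_left (norm_nonneg _) ht
    refine hx ?_
    have h3 : fderiv ℝ f x = 0 := fderiv_of_notMem_tsupport (𝕜 := ℝ) h1
    simp [φ, h3, image_eq_zero_of_notMem_tsupport h1, image_eq_zero_of_notMem_tsupport h2]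
  let d : ℝ → 𝓓^{⊤}_{K}(Spacetime, ℝ) := fun t => open Classical in
    if ht : |t| ≤ 1 then ContDiffMapSupportedIn.of_support_subset (hφ t) (hsupp t ht) else 0
  have hd (t : ℝ) (ht : |t| ≤ 1) (x : Spacetime) : d t x = φ t x := by
    simp only [d, dif_pos ht]
    rfl
  have hsmall : ∀ᶠ t : ℝ in 𝓝[≠] 0, |t| ≤ 1 := by
    refine nhdsWithin_le_nhds ?_
    have : Metric.closedBall (0 : ℝ) 1 ∈ 𝓝 (0 : ℝ) := Metric.closedBall_mem_nhds _ one_pos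
    filter_upwards [this] with t ht
    simpa using ht
  have hlim : Tendsto d (𝓝[≠] 0) (𝓝 0) := by
    rw [(ContDiffMapSupportedIn.withSeminorms ℝ Spacetime ℝ ⊤ K).tendsto_nhds]
    intro i ε hε
    obtain ⟨C, hC0, hC⟩ := exists_iteratedFDeriv_diffQuotient_le e i f f.contDiff f.hasCompactSupport
    have ht0 : Tendsto (fun t : ℝ => C * |t|) (𝓝[≠] 0) (𝓝 0) := by
      have : Tendsto (fun t : ℝ => C * |t|) (𝓝 0) (𝓝 (C * |0|)) := Continuous.tendsto (by fun_prop) 0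
      simpa using this.mono_left nhdsWithin_le_nhds
    filter_upwards [hsmall, self_mem_nhdsWithin, ht0.eventually_lt_const hε] with t ht ht0 htε
    rw [sub_zero]
    refine lt_of_le_of_lt ((ContDiffMapSupportedIn.seminorm_top_le_iff ℝ
      (mul_nonneg hC0 (abs_nonneg t)) i (d t)).2 fun x _ => ?_) htε
    have : (d t : Spacetime → ℝ) = φ t := funext (hd t ht)
    rw [this]
    exact hC t ht0 x
  have hcont := (TestFunction.continuous_ofSupportedIn (n := ⊤) (F := ℝ) (K := K)
    (Ω := (⊤ : Opens Spacetime)) (fun _ _ => trivial)).tendsto 0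
  have h := (hcont.comp hlim).add_const (-pderiv 0 f)
  have hz : TestFunction.ofSupportedIn (Ω := (⊤ : Opens Spacetime)) (fun _ _ => trivial)
      (0 : 𝓓^{⊤}_{K}(Spacetime, ℝ)) + -pderiv 0 f = -pderiv 0 f := by
    ext x
    change (0 : ℝ) + -(pderiv 0 f x) = -(pderiv 0 f x)
    rw [zero_add]
  rw [hz] at h
  refine h.congr' ?_
  filter_upwards [hsmall] with t ht
  ext x
  change d t x + -(pderiv 0 f x) = t⁻¹ • (translate (t • e) f x - f x)
  rw [hd t ht, pderiv_apply, translate_apply]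
  simp only [φ, e]
  ring

theorem hasDerivAt_translate {V : Type*} [NormedAddCommGroup V] [NormedSpace ℝ V]
    {L : TestFn → V} (hL : IsLinearMap ℝ L) (hc : Continuous L) (f : TestFn) :
    HasDerivAt (fun t : ℝ => L (translate (t, 0) f)) (-L (pderiv 0 f)) 0 := by
  rw [hasDerivAt_iff_tendsto_slope_zero]
  have h := (hc.tendsto _).comp (tendsto_translate_diffQuotient f)
  rw [hL.map_neg] at h
  refine h.congr fun t => ?_
  have h1 : t • dir 0 = (t, (0 : Space)) := by simp [dir]
  have h2 : translate ((0 : ℝ), (0 : Space)) f = f := by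
    ext x
    rw [translate_apply]
    congr 1
    exact sub_zero x
  simp only [Function.comp_apply, zero_add, h1, h2]
  rw [hL.map_smul, hL.map_sub]

/-! ### A lattice partition of unity -/

/-- A smooth bump on `[-1, 1]` whose integer translates add up to one. -/
def unitBump (s : ℝ) : ℝ := Real.smoothTransition (s + 1) - Real.smoothTransition s

/-- `unitBump' s = stepBump s - stepBump (s - 1)`. -/
def stepBump (s : ℝ) : ℝ := deriv Real.smoothTransition (s + 1)

theorem contDiff_unitBump : ContDiff ℝ (⊤ : ℕ∞) unitBump :=
  (Real.smoothTransition.contDiff.comp (contDiff_id.add contDiff_const)).sub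
    Real.smoothTransition.contDiff

theorem contDiff_stepBump : ContDiff ℝ (⊤ : ℕ∞) stepBump := by
  have h : ContDiff ℝ (⊤ : ℕ∞) (deriv Real.smoothTransition) := by
    have : ContDiff ℝ (⊤ : ℕ∞) Real.smoothTransition := Real.smoothTransition.contDiff
    exact (contDiff_infty_iff_deriv.1 this).2
  exact h.comp (contDiff_id.add contDiff_const)

theorem unitBump_eq_zero {s : ℝ} (hs : 1 < |s|) : unitBump s = 0 := by
  rcases lt_abs.1 hs with h | h
  · rw [unitBump, Real.smoothTransition.one_of_one_le (by linarith),
      Real.smoothTransition.one_of_one_le (by linarith), sub_self]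
  · rw [unitBump, Real.smoothTransition.zero_of_nonpos (by linarith),
      Real.smoothTransition.zero_of_nonpos (by linarith), sub_self]

theorem stepBump_eq_zero {s : ℝ} (hs : 1 < |s|) : stepBump s = 0 := by
  rcases lt_abs.1 hs with h | h
  · have : Real.smoothTransition =ᶠ[𝓝 (s + 1)] fun _ => 1 := by
      filter_upwards [Ioi_mem_nhds (show (1 : ℝ) < s + 1 by linarith)] with t ht
      exact Real.smoothTransition.one_of_one_le (le_of_lt ht)
    rw [stepBump, this.deriv_eq, deriv_const]
  · have : Real.smoothTransition =ᶠ[𝓝 (s + 1)] fun _ => 0 := by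
      filter_upwards [Iio_mem_nhds (show s + 1 < (0 : ℝ) by linarith)] with t ht
      exact Real.smoothTransition.zero_of_nonpos (le_of_lt ht)
    rw [stepBump, this.deriv_eq, deriv_const]

theorem hasDerivAt_unitBump (s : ℝ) : HasDerivAt unitBump (stepBump s - stepBump (s - 1)) s := by
  have hd : Differentiable ℝ Real.smoothTransition :=
    (Real.smoothTransition.contDiff (n := 1)).differentiable (by simp)
  have h := ((hd (s + 1)).hasDerivAt.comp_add_const s 1).sub (hd s).hasDerivAt
  simp only [stepBump, sub_add_cancel]
  exact h

/-- The sum telescopes to a difference of two values of the smooth step, one past its upper end and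
one before its lower end. -/
theorem sum_unitBump {N : ℕ} {s : ℝ} (hs : |s| ≤ N) :
    ∑ k ∈ Finset.Icc (-(N : ℤ)) N, unitBump (s - k) = 1 := by
  have key : ∀ m : ℕ, ∑ k ∈ Finset.Ico (-(N : ℤ)) (-(N : ℤ) + m), unitBump (s - k)
      = Real.smoothTransition (s + N + 1) - Real.smoothTransition (s + N + 1 - m) := by
    intro m
    induction m with
    | zero => simp
    | succ m ih =>
      have h1 : Finset.Ico (-(N : ℤ)) (-(N : ℤ) + (m + 1 : ℕ))
          = insert (-(N : ℤ) + m) (Finset.Ico (-(N : ℤ)) (-(N : ℤ) + m)) := by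
        ext k
        simp only [Finset.mem_Ico, Finset.mem_insert]
        push_cast
        omega
      rw [h1, Finset.sum_insert (by simp), ih, unitBump]
      push_cast
      ring_nf
  have h2 : Finset.Icc (-(N : ℤ)) N = Finset.Ico (-(N : ℤ)) (-(N : ℤ) + (2 * N + 1 : ℕ)) := by
    ext k
    simp only [Finset.mem_Icc, Finset.mem_Ico]
    push_cast
    omega
  have := abs_le.1 hs
  rw [h2, key, Real.smoothTransition.one_of_one_le (by linarith),
    Real.smoothTransition.zero_of_nonpos, sub_zero]
  push_cast
  linarith

/-- The product `∏ⱼ βⱼ(yⱼ)`. -/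
def prodFn (β : Fin 3 → ℝ → ℝ) (y : Space) : ℝ := ∏ j, β j (y j)

theorem contDiff_prodFn {β : Fin 3 → ℝ → ℝ} (hβ : ∀ j, ContDiff ℝ (⊤ : ℕ∞) (β j)) :
    ContDiff ℝ (⊤ : ℕ∞) (prodFn β) := by
  refine contDiff_prod fun j _ => (hβ j).comp ?_
  exact (EuclideanSpace.proj (𝕜 := ℝ) j : Space →L[ℝ] ℝ).contDiff

theorem prodFn_eq_zero {β : Fin 3 → ℝ → ℝ} (hβ : ∀ j s, 1 < |s| → β j s = 0) {y : Space} {j : Fin 3}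
    (hj : 1 < |y j|) : prodFn β y = 0 :=
  Finset.prod_eq_zero (Finset.mem_univ j) (hβ j _ hj)

theorem norm_le_of_coord_le {y : Space} {c : ℝ} (hc : 0 ≤ c)
    (h : ∀ j, |y j| ≤ c) : ‖y‖ ≤ 2 * c := by
  rw [EuclideanSpace.norm_eq]
  refine Real.sqrt_le_iff.2 ⟨by positivity, ?_⟩
  calc ∑ j, ‖y j‖ ^ 2 ≤ ∑ _j : Fin 3, c ^ 2 :=
        Finset.sum_le_sum fun j _ => pow_le_pow_left₀ (norm_nonneg _) (h j) 2
    _ ≤ (2 * c) ^ 2 := by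
        simp
        nlinarith [sq_nonneg c]

theorem coord_le_norm (y : Space) (j : Fin 3) : |y j| ≤ ‖y‖ := PiLp.norm_apply_le y j

theorem prodFn_eq_zero_of_norm {β : Fin 3 → ℝ → ℝ} (hβ : ∀ j s, 1 < |s| → β j s = 0) {y : Space}
    (hy : 2 < ‖y‖) : prodFn β y = 0 := by
  by_contra h
  have : ∀ j, |y j| ≤ 1 := fun j => by
    by_contra! hj
    exact h (prodFn_eq_zero hβ hj)
  linarith [norm_le_of_coord_le zero_le_one this]

/-- The test function `f(x₀) ∏ⱼ βⱼ(xⱼ)`. -/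
def tensor (f : 𝓓((⊤ : Opens ℝ), ℝ)) (β : Fin 3 → ℝ → ℝ) (hβ : ∀ j, ContDiff ℝ (⊤ : ℕ∞) (β j))
    (hβ0 : ∀ j s, 1 < |s| → β j s = 0) : TestFn where
  toFun x := f x.1 * prodFn β x.2
  contDiff' := (f.contDiff.comp contDiff_fst).mul ((contDiff_prodFn hβ).comp contDiff_snd)
  hasCompactSupport' := by
    refine HasCompactSupport.of_support_subset_isCompact
      (f.hasCompactSupport.isCompact.prod (isCompact_closedBall (0 : Space) 2)) fun x hx => ?_
    rw [Function.mem_support] at hx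
    refine ⟨subset_tsupport _ (left_ne_zero_of_mul hx), ?_⟩
    rw [mem_closedBall_zero_iff]
    by_contra! h
    exact right_ne_zero_of_mul hx (prodFn_eq_zero_of_norm hβ0 h)
  tsupport_subset' := fun _ _ => trivial

/-- The cell function `f ⊗ χ` with `χ(y) = ∏ⱼ unitBump(yⱼ)`. -/
def cellFn (f : 𝓓((⊤ : Opens ℝ), ℝ)) : TestFn :=
  tensor f (fun _ => unitBump) (fun _ => contDiff_unitBump) fun _ _ => unitBump_eq_zero

/-- The flux function through the faces of the cell in direction `i`. -/
def fluxFn (f : 𝓓((⊤ : Opens ℝ), ℝ)) (i : Fin 3) : TestFn :=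
  tensor f (Function.update (fun _ => unitBump) i stepBump)
    (fun j => by
      by_cases h : j = i
      · subst h
        rw [Function.update_self]
        exact contDiff_stepBump
      · rw [Function.update_of_ne h]
        exact contDiff_unitBump)
    (fun j s hs => by
      by_cases h : j = i
      · subst h
        rw [Function.update_self]
        exact stepBump_eq_zero hs
      · rw [Function.update_of_ne h]
        exact unitBump_eq_zero hs)

theorem cellFn_apply (f : 𝓓((⊤ : Opens ℝ), ℝ)) (x : Spacetime) :
    cellFn f x = f x.1 * ∏ j, unitBump (x.2 j) := rfl

theorem fluxFn_apply (f : 𝓓((⊤ : Opens ℝ), ℝ)) (i : Fin 3) (x : Spacetime) :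
    fluxFn f i x = f x.1 * (stepBump (x.2 i) * ∏ j ∈ Finset.univ.erase i, unitBump (x.2 j)) := by
  change f x.1 * ∏ j, Function.update (fun _ => unitBump) i stepBump j (x.2 j) = _
  rw [← Finset.mul_prod_erase _ _ (Finset.mem_univ i), Function.update_self]
  congr 2
  refine Finset.prod_congr rfl fun j hj => ?_
  rw [Function.update_of_ne (Finset.ne_of_mem_erase hj)]

theorem dir_succ (i : Fin 3) : dir i.succ = ((0 : ℝ), (EuclideanSpace.single i 1 : Space)) := by
  simp [dir]

/-- The reason for this choice of bump: the derivative of a cell is an exact lattice difference of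
fluxes, so divergences on the lattice telescope. -/
theorem pderiv_cellFn (f : 𝓓((⊤ : Opens ℝ), ℝ)) (i : Fin 3) :
    pderiv i.succ (cellFn f) = fluxFn f i - translate (dir i.succ) (fluxFn f i) := by
  ext x
  change _ = fluxFn f i x - translate (dir i.succ) (fluxFn f i) x
  rw [translate_apply, fluxFn_apply, fluxFn_apply, pderiv_apply]
  have hdiff : DifferentiableAt ℝ (cellFn f) x :=
    ((cellFn f).contDiff.differentiable (by simp)).differentiableAt
  rw [← hdiff.lineDeriv_eq_fderiv]
  have hline : HasLineDerivAt ℝ (cellFn f)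
      (f x.1 * ((stepBump (x.2 i) - stepBump (x.2 i - 1)) *
        ∏ j ∈ Finset.univ.erase i, unitBump (x.2 j))) x (dir i.succ) := by
    have hfun : (fun t : ℝ => cellFn f (x + t • dir i.succ)) = fun t : ℝ =>
        f x.1 * (unitBump (x.2 i + t) * ∏ j ∈ Finset.univ.erase i, unitBump (x.2 j)) := by
      funext t
      rw [cellFn_apply, dir_succ, ← Finset.mul_prod_erase _ _ (Finset.mem_univ i)]
      have h1 : (x + t • ((0 : ℝ), (EuclideanSpace.single i 1 : Space))).1 = x.1 := by simp
      have h2 : (x + t • ((0 : ℝ), (EuclideanSpace.single i 1 : Space))).2 i = x.2 i + t := by simp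
      rw [h1, h2]
      congr 2
      refine Finset.prod_congr rfl fun j hj => ?_
      simp [Finset.ne_of_mem_erase hj]
    rw [HasLineDerivAt, hfun]
    have h := hasDerivAt_unitBump (x.2 i + 0)
    have h2 := h.comp_const_add (x.2 i) 0
    rw [add_zero] at h2
    exact (h2.mul_const _).const_mul _
  rw [hline.lineDeriv, dir_succ]
  have h1 : (x - ((0 : ℝ), (EuclideanSpace.single i 1 : Space))).1 = x.1 := by simp
  have h2 : (x - ((0 : ℝ), (EuclideanSpace.single i 1 : Space))).2 i = x.2 i - 1 := by simp
  have h3 : ∏ j ∈ Finset.univ.erase i,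
      unitBump ((x - ((0 : ℝ), (EuclideanSpace.single i 1 : Space))).2 j)
      = ∏ j ∈ Finset.univ.erase i, unitBump (x.2 j) := by
    refine Finset.prod_congr rfl fun j hj => ?_
    simp [Finset.ne_of_mem_erase hj]
  rw [h1, h2, h3]
  ring

/-- A lattice point as a purely spatial vector. -/
def latticePoint (k : Lattice) : Spacetime := (0, WithLp.toLp 2 fun j => (k j : ℝ))

theorem latticePoint_add (k l : Lattice) :
    latticePoint (k + l) = latticePoint k + latticePoint l := by
  refine Prod.ext (by simp [latticePoint]) ?_
  ext j
  simp [latticePoint]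

theorem latticePoint_single (i : Fin 3) : latticePoint (Pi.single i 1) = dir i.succ := by
  rw [dir_succ]
  refine Prod.ext rfl ?_
  ext j
  by_cases h : j = i
  · subst h
    simp [latticePoint]
  · simp [latticePoint, h]

/-- The cutoff function `f ⊗ v` with `v = ∑ₖ G(k) χ(· - k)`. -/
def latticeSmear (f : 𝓓((⊤ : Opens ℝ), ℝ)) (n : ℕ) : TestFn :=
  ∑ k ∈ latticeBox (6 * n), latticeCutoff n k • translate (latticePoint k) (cellFn f)

theorem latticeSmear_apply (f : 𝓓((⊤ : Opens ℝ), ℝ)) (n : ℕ) (x : Spacetime) :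
    latticeSmear f n x = f x.1 * ∑ k ∈ latticeBox (6 * n),
      latticeCutoff n k * ∏ j, unitBump (x.2 j - k j) := by
  let ev : TestFn →+ ℝ := ⟨⟨fun g => g x, rfl⟩, fun _ _ => rfl⟩
  have h : latticeSmear f n x = ∑ k ∈ latticeBox (6 * n),
      latticeCutoff n k * translate (latticePoint k) (cellFn f) x :=
    map_sum ev _ _
  rw [h, Finset.mul_sum]
  refine Finset.sum_congr rfl fun k _ => ?_
  rw [translate_apply, cellFn_apply]
  simp [latticePoint]
  ring

/-- Cells with index beyond 4n do not reach the ball of radius 3n, and the remaining weights are 1,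
so the partition of unity is complete there. The radius 3n leaves room for a fixed radius,
eventually below n, plus translations by up to 2n. -/
theorem latticeSmear_eq {f : 𝓓((⊤ : Opens ℝ), ℝ)} {n : ℕ} (hn : 0 < n) {x : Spacetime}
    (hx : ‖x.2‖ ≤ 3 * n) : latticeSmear f n x = f x.1 := by
  rw [latticeSmear_apply]
  have hn1 : (1 : ℝ) ≤ n := by exact_mod_cast hn
  have hcoord (j : Fin 3) : |x.2 j| ≤ 3 * n := (coord_le_norm x.2 j).trans hx
  have h1 : ∀ k ∈ latticeBox (6 * n), latticeCutoff n k * ∏ j, unitBump (x.2 j - k j)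
      = ∏ j, unitBump (x.2 j - k j) := by
    intro k _
    by_cases hk : ‖k‖ ≤ 4 * n
    · rw [latticeCutoff_eq_one hn hk, one_mul]
    · have : ∃ j, 4 * (n : ℝ) < ‖k j‖ := by
        by_contra! h
        exact hk ((pi_norm_le_iff_of_nonneg (by positivity)).2 h)
      obtain ⟨j, hj⟩ := this
      have hz : ∏ j, unitBump (x.2 j - k j) = 0 := by
        refine Finset.prod_eq_zero (Finset.mem_univ j) (unitBump_eq_zero ?_)
        have h2 : |(k j : ℝ)| ≤ |x.2 j| + |x.2 j - k j| := by
          have := abs_sub (x.2 j) (x.2 j - k j)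
          rwa [sub_sub_cancel] at this
        have h3 : ‖k j‖ = |(k j : ℝ)| := Int.norm_eq_abs _
        have := hcoord j
        linarith
      rw [hz, mul_zero]
  rw [Finset.sum_congr rfl h1, latticeBox, ← Finset.prod_univ_sum (fun _ => Finset.Icc (-((6 * n : ℕ) : ℤ)) (6 * n : ℕ))
    (fun j (m : ℤ) => unitBump (x.2 j - m))]
  have h2 (j : Fin 3) : ∑ m ∈ Finset.Icc (-((6 * n : ℕ) : ℤ)) (6 * n : ℕ), unitBump (x.2 j - m) = 1 := by
    refine sum_unitBump ((hcoord j).trans ?_)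
    push_cast
    linarith
  rw [Finset.prod_congr rfl fun j _ => h2 j, Finset.prod_const_one, mul_one]

theorem latticeSmear_eq_zero {f : 𝓓((⊤ : Opens ℝ), ℝ)} (n : ℕ) {x : Spacetime} (hx : f x.1 = 0) :
    latticeSmear f n x = 0 := by
  rw [latticeSmear_apply, hx, zero_mul]

section Net

variable {A : Type*} [CStarAlgebra A] [PartialOrder A] [StarOrderedRing A]
variable {H : Type*} [NormedAddCommGroup H] [InnerProductSpace ℂ H] [CompleteSpace H]
variable {N : LocalNet A} {ω : A →ₚ[ℂ] ℂ} {r : InvariantRep N ω H}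

/-! ### The vectors `J_μ(f) Ω` -/

namespace ConservedCurrent

variable (j : ConservedCurrent r)

/-- The vector `J_μ(f) Ω`. -/
def vec (μ : Fin 4) (f : TestFn) : H := j.J μ f ⟨r.Ω, j.mem_domain μ f⟩

theorem isLinearMap_vec (μ : Fin 4) : IsLinearMap ℝ (j.vec μ) := j.linear μ

theorem vec_sub (μ : Fin 4) (f g : TestFn) : j.vec μ (f - g) = j.vec μ f - j.vec μ g :=
  (j.isLinearMap_vec μ).map_sub f g

theorem T_vec (μ : Fin 4) (f : TestFn) (x : Spacetime) :
    r.T x (j.vec μ f) = j.vec μ (translate x f) := by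
  obtain ⟨h, hx⟩ := j.covariant μ f x ⟨r.Ω, j.mem_domain μ f⟩
  rw [vec, vec, ← hx]
  congr 2
  exact r.T_Ω x

theorem sum_vec_pderiv (f : TestFn) : ∑ μ, j.vec μ (pderiv μ f) = 0 :=
  j.conserved f r.Ω fun μ => j.mem_domain μ _

/-- Covariance turns the time derivative into -J₀(∂₀f)Ω, which the conservation law replaces by the
spatial divergence. -/
theorem hasDerivAt_T_vec (f : TestFn) :
    HasDerivAt (fun t : ℝ => r.T (t, 0) (j.vec 0 f))
      (∑ i : Fin 3, j.vec i.succ (pderiv i.succ f)) 0 := by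
  have h := hasDerivAt_translate (j.isLinearMap_vec 0) (j.continuous 0) f
  have h2 := j.sum_vec_pderiv f
  rw [Fin.sum_univ_succ] at h2
  rw [neg_eq_of_add_eq_zero_right h2] at h
  simp only [T_vec]
  exact h

theorem inner_vec_Ω (f : TestFn) : inner ℂ (j.vec 0 f) r.Ω = inner ℂ r.Ω (j.vec 0 f) := by
  have hS := j.selfAdjoint 0 f
  have h := LinearPMap.adjoint_isFormalAdjoint hS.dense_domain
  rw [LinearPMap.isSelfAdjoint_def.1 hS] at h
  exact h ⟨r.Ω, j.mem_domain 0 f⟩ ⟨r.Ω, j.mem_domain 0 f⟩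

/-- A large ball about the support of `f` is convex, hence an admissible contractible region. -/
theorem vec_mem_selfAdjointVectors (f : TestFn) : j.vec 0 f ∈ r.selfAdjointVectors := by
  obtain ⟨R, hR⟩ := f.hasCompactSupport.isCompact.isBounded.subset_ball_lt 0 0
  let O : Region :=
    { carrier := Metric.ball 0 R
      isOpen := Metric.isOpen_ball
      isBounded := Metric.isBounded_ball
      contractible := (convex_ball _ _).contractibleSpace ⟨0, Metric.mem_ball_self hR.1⟩ }
  exact r.apply_Ω_mem_selfAdjointVectors (j.selfAdjoint 0 f) (j.affiliated f O hR.2)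
    (j.mem_domain 0 f)

/-! ### The commutator of the charge with its time derivative -/

theorem vec_latticeSmear (f : 𝓓((⊤ : Opens ℝ), ℝ)) (n : ℕ) :
    j.vec 0 (latticeSmear f n) = ∑ k ∈ latticeBox (6 * n),
      (latticeCutoff n k : ℂ) • r.T (latticePoint k) (j.vec 0 (cellFn f)) := by
  have h := map_sum ((j.isLinearMap_vec 0).mk' (j.vec 0))
    (fun k => latticeCutoff n k • translate (latticePoint k) (cellFn f)) (latticeBox (6 * n))
  refine h.trans (Finset.sum_congr rfl fun k _ => ?_)
  rw [map_smul, T_vec, Complex.coe_smul]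
  rfl

theorem vec_pderiv_latticeSmear (f : 𝓓((⊤ : Opens ℝ), ℝ)) (n : ℕ) (i : Fin 3) :
    j.vec i.succ (pderiv i.succ (latticeSmear f n)) = ∑ k ∈ latticeBox (6 * n),
      (latticeCutoff n k : ℂ) • (r.T (latticePoint k) (j.vec i.succ (fluxFn f i))
        - r.T (latticePoint (k + Pi.single i 1)) (j.vec i.succ (fluxFn f i))) := by
  have h1 : pderiv i.succ (latticeSmear f n) = ∑ k ∈ latticeBox (6 * n),
      latticeCutoff n k • translate (latticePoint k) (fluxFn f i - translate (dir i.succ) (fluxFn f i)) := by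
    have h := map_sum (TestFunction.lineDerivCLM (n := ⊤) (k := ⊤) ℝ (dir i.succ) : TestFn →L[ℝ] TestFn)
      (fun k => latticeCutoff n k • translate (latticePoint k) (cellFn f)) (latticeBox (6 * n))
    refine h.trans (Finset.sum_congr rfl fun k _ => ?_)
    rw [map_smul, ← pderiv_cellFn, ← pderiv_translate]
    rfl
  rw [h1]
  have h := map_sum ((j.isLinearMap_vec i.succ).mk' (j.vec i.succ))
    (fun k => latticeCutoff n k •
      translate (latticePoint k) (fluxFn f i - translate (dir i.succ) (fluxFn f i)))
    (latticeBox (6 * n))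
  refine h.trans (Finset.sum_congr rfl fun k _ => ?_)
  rw [map_smul, Complex.coe_smul]
  congr 1
  change j.vec i.succ _ = _
  rw [← T_vec, vec_sub, map_sub, ← T_vec, ← r.T_add, ← latticePoint_single, ← latticePoint_add]

theorem tsupport_tensor_translate_subset {f : 𝓓((⊤ : Opens ℝ), ℝ)} {d : ℝ}
    (hf : ∀ t, d ≤ |t| → f t = 0) (β : Fin 3 → ℝ → ℝ) (hβ : ∀ j, ContDiff ℝ (⊤ : ℕ∞) (β j))
    (hβ0 : ∀ j s, 1 < |s| → β j s = 0) (y : Space) :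
    tsupport (translate (0, y) (tensor f β hβ hβ0)) ⊆ {x | |x.1| ≤ d ∧ ‖x.2 - y‖ ≤ 2} := by
  refine closure_minimal (fun x hx => ?_) ?_
  · have hx' : f (x.1 - 0) * prodFn β (x.2 - y) ≠ 0 := hx
    rw [sub_zero] at hx'
    constructor
    · by_contra! h
      exact left_ne_zero_of_mul hx' (hf _ h.le)
    · by_contra! h
      exact right_ne_zero_of_mul hx' (prodFn_eq_zero_of_norm hβ0 h)
  · exact (isClosed_le (by fun_prop : Continuous fun x : Spacetime => |x.1|) continuous_const).inter
      (isClosed_le (by fun_prop : Continuous fun x : Spacetime => ‖x.2 - y‖) continuous_const)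

theorem norm_le_norm_latticePoint (k : Lattice) : ‖k‖ ≤ ‖(latticePoint k).2‖ := by
  refine (pi_norm_le_iff_of_nonneg (norm_nonneg _)).2 fun i => ?_
  rw [Int.norm_eq_abs]
  exact coord_le_norm (latticePoint k).2 i

/-- The correlation of the flux and the cell vectors as a function of the lattice distance. -/
def fluxKernel (f : 𝓓((⊤ : Opens ℝ), ℝ)) (i : Fin 3) (z : Lattice) : ℝ :=
  (inner ℂ (r.T (latticePoint z) (j.vec i.succ (fluxFn f i))) (j.vec 0 (cellFn f))).im

/-- The imaginary part is half a commutator. Both supports have spatial radius at most 2 and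
temporal radius at most `d`, so they are space-like separated beyond distance 4 + 2d. -/
theorem finite_support_fluxKernel {f : 𝓓((⊤ : Opens ℝ), ℝ)} {d : ℝ}
    (hf : ∀ t, d ≤ |t| → f t = 0) (i : Fin 3) : (Function.support (j.fluxKernel f i)).Finite := by
  refine Set.Finite.subset (latticeBox ⌈4 + 2 * d⌉₊).finite_toSet fun z hz => ?_
  rw [Finset.mem_coe, mem_latticeBox]
  by_contra! hz'
  refine hz ?_
  have hz2 : 4 + 2 * d < ‖(latticePoint z).2‖ :=
    (Nat.le_ceil _).trans_lt (hz'.trans_le (norm_le_norm_latticePoint z))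
  have hcell : cellFn f = translate (0, 0) (cellFn f) := by
    ext x
    rw [translate_apply]
    congr 1
    exact (sub_zero x).symm
  have hsp : Spacelike (tsupport (cellFn f))
      (tsupport (translate (latticePoint z) (fluxFn f i))) := by
    intro x hx y hy
    rw [hcell] at hx
    have h1 := tsupport_tensor_translate_subset hf _ _ _ 0 hx
    have h2 := tsupport_tensor_translate_subset hf _ _ _ (latticePoint z).2 hy
    have h3 : |x.1 - y.1| ≤ |x.1| + |y.1| := abs_sub x.1 y.1
    have h4 : ‖(latticePoint z).2‖ ≤ ‖x.2 - y.2‖ + ‖x.2 - 0‖ + ‖y.2 - (latticePoint z).2‖ := by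
      have h5 : (latticePoint z).2 = (x.2 - 0) - (x.2 - y.2) - (y.2 - (latticePoint z).2) := by abel
      have h6 := norm_sub_le ((x.2 - 0) - (x.2 - y.2)) (y.2 - (latticePoint z).2)
      rw [← h5] at h6
      linarith [norm_sub_le (x.2 - 0) (x.2 - y.2)]
    linarith [h1.1, h1.2, h2.1, h2.2]
  have h := j.local_currents i _ _ hsp
  change inner ℂ (j.vec 0 (cellFn f)) (j.vec i.succ (translate (latticePoint z) (fluxFn f i)))
    - inner ℂ (j.vec i.succ (translate (latticePoint z) (fluxFn f i))) (j.vec 0 (cellFn f)) = 0 at h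
  rw [← T_vec, ← inner_conj_symm (j.vec 0 (cellFn f)), sub_eq_zero] at h
  exact Complex.conj_eq_iff_im.1 h

theorem im_inner_T (x y : Lattice) (ξ η : H) :
    inner ℂ (r.T (latticePoint x) ξ) (r.T (latticePoint y) η)
      = inner ℂ (r.T (latticePoint (x - y)) ξ) η := by
  have h : latticePoint x = latticePoint y + latticePoint (x - y) := by
    rw [← latticePoint_add, add_sub_cancel]
  rw [h, r.T_add, LinearIsometryEquiv.inner_map_map]

theorem exists_commutator_le {f : 𝓓((⊤ : Opens ℝ), ℝ)} (hf : IsTimeCutoff f) :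
    ∃ C : ℝ, ∀ᶠ n : ℕ in atTop,
      ‖inner ℂ (j.vec 0 (latticeSmear f n))
          (∑ i : Fin 3, j.vec i.succ (pderiv i.succ (latticeSmear f n)))
        - inner ℂ (∑ i : Fin 3, j.vec i.succ (pderiv i.succ (latticeSmear f n)))
          (j.vec 0 (latticeSmear f n))‖ ≤ C * n := by
  obtain ⟨-, d, -, hd⟩ := hf
  -- Coupling the charge to its divergence produces a lattice difference of the flux kernel; being a
  -- difference of two translates, it has sum zero.
  let κ : Fin 3 → Lattice → ℝ := fun i z =>
    j.fluxKernel f i z - j.fluxKernel f i (z + Pi.single i 1)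
  have hfin (i : Fin 3) := j.finite_support_fluxKernel hd i
  have hfin' (i : Fin 3) :
      (Function.support fun z => j.fluxKernel f i (z + Pi.single i 1)).Finite :=
    (hfin i).preimage (f := fun z : Lattice => z + Pi.single i 1)
      fun _ _ _ _ h => add_right_cancel h
  have hκfin (i : Fin 3) : (Function.support (κ i)).Finite :=
    ((hfin i).union (hfin' i)).subset (Function.support_sub _ _)
  have hκsum (i : Fin 3) : ∑ᶠ z, κ i z = 0 := by
    rw [finsum_sub_distrib (hfin i) (hfin' i), sub_eq_zero]
    exact (finsum_comp_equiv (Equiv.addRight (Pi.single i 1)) (f := j.fluxKernel f i)).symm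
  choose C hC using fun i => exists_lattice_form_le (κ i) (hκfin i) (hκsum i)
  refine ⟨2 * ∑ i, C i, ?_⟩
  filter_upwards [eventually_all.2 hC] with n hn
  set ψ := j.vec 0 (latticeSmear f n) with hψ
  have him (i : Fin 3) : (inner ℂ (j.vec i.succ (pderiv i.succ (latticeSmear f n))) ψ).im
      = ∑ k ∈ latticeBox (6 * n), ∑ l ∈ latticeBox (6 * n),
        κ i (k - l) * (latticeCutoff n k * latticeCutoff n l) := by
    rw [vec_pderiv_latticeSmear, hψ, vec_latticeSmear, sum_inner, Complex.im_sum]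
    refine Finset.sum_congr rfl fun k _ => ?_
    rw [inner_sum, Complex.im_sum]
    refine Finset.sum_congr rfl fun l _ => ?_
    rw [inner_smul_left, inner_smul_right, inner_sub_left, im_inner_T, im_inner_T,
      Complex.conj_ofReal, Complex.im_ofReal_mul, Complex.im_ofReal_mul, Complex.sub_im]
    have : k + Pi.single i 1 - l = k - l + Pi.single i 1 := by abel
    rw [this]
    simp only [κ, fluxKernel]
    ring
  set ψ' := ∑ i : Fin 3, j.vec i.succ (pderiv i.succ (latticeSmear f n)) with hψ'
  have h1 : inner ℂ ψ ψ' - inner ℂ ψ' ψ = -((2 * (inner ℂ ψ' ψ).im : ℝ) * Complex.I) := by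
    rw [← inner_conj_symm ψ ψ', ← Complex.sub_conj]
    ring
  rw [h1, norm_neg, norm_mul, Complex.norm_I, mul_one, Complex.norm_real, Real.norm_eq_abs, abs_mul,
    abs_two, mul_assoc, hψ', sum_inner, Complex.im_sum]
  gcongr
  rw [Finset.sum_mul]
  refine (Finset.abs_sum_le_sum_abs _ _).trans (Finset.sum_le_sum fun i _ => ?_)
  rw [him]
  exact hn i

/-! ### The charge commutator -/

theorem chargeComm_eq (f : TestFn) (a : A) :
    j.chargeComm f a = inner ℂ (j.vec 0 f) (r.vec a) - inner ℂ (r.vec (star a)) (j.vec 0 f) := rfl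

theorem chargeComm_sub_left (f g : TestFn) (a : A) :
    j.chargeComm (f - g) a = j.chargeComm f a - j.chargeComm g a := by
  simp only [chargeComm_eq, vec_sub, inner_sub_left, inner_sub_right]
  ring

/-- The charge commutator as a linear functional of the observable. -/
def chargeCommLM (f : TestFn) : A →ₗ[ℂ] ℂ where
  toFun := j.chargeComm f
  map_add' a b := by
    simp only [chargeComm_eq, star_add, map_add, inner_add_left, inner_add_right]
    ring
  map_smul' c a := by
    simp only [chargeComm_eq, star_smul, map_smul, inner_smul_left, inner_smul_right,
      RingHom.id_apply, smul_eq_mul]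
    rw [← starRingEnd_apply, Complex.conj_conj]
    ring

/-- Self-adjointness of J₀(f) makes ⟨Ω, J₀(f)Ω⟩ real. Hence subtracting the mean from an observable
does not change the commutator. -/
theorem chargeComm_one (f : TestFn) : j.chargeComm f 1 = 0 := by
  rw [chargeComm_eq, star_one, r.vec_one, inner_vec_Ω, sub_self]

theorem chargeComm_trans (f : TestFn) (x : Spacetime) (a : A) :
    j.chargeComm f (N.trans x a) = j.chargeComm (translate (-x) f) a := by
  have h : j.vec 0 f = r.T x (j.vec 0 (translate (-x) f)) := by
    rw [T_vec, translate_translate, add_neg_cancel]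
    congr 1
    ext y
    rw [translate_apply, sub_zero]
  rw [chargeComm_eq, chargeComm_eq, h, ← map_star, ← r.T_vec, ← r.T_vec,
    LinearIsometryEquiv.inner_map_map, LinearIsometryEquiv.inner_map_map]

theorem smear_apply (f : 𝓓((⊤ : Opens ℝ), ℝ)) (g : 𝓓((⊤ : Opens Space), ℝ)) {R : ℝ} (hR : 0 < R)
    (x : Spacetime) : smear f g R x = f x.1 * g (R⁻¹ • x.2) := by
  rw [smear, dif_pos hR]
  rfl

/-- By locality, the charge commutator with a local observable does not depend on the cutoff once
this is large enough. -/
theorem exists_chargeComm_eq {a : A} (ha : a ∈ N.strictlyLocal) {f : 𝓓((⊤ : Opens ℝ), ℝ)}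
    (hf : IsTimeCutoff f) {g : 𝓓((⊤ : Opens Space), ℝ)} (hg : IsSpaceCutoff g) {c : ℂ}
    (hc : Tendsto (fun R => j.chargeComm (smear f g R) a) atTop (𝓝 c)) :
    ∃ ρ : ℝ, ∀ w : TestFn, (∀ x : Spacetime, ‖x.2‖ ≤ ρ → w x = f x.1) →
      (∀ x : Spacetime, f x.1 = 0 → w x = 0) → j.chargeComm w a = c := by
  obtain ⟨O, ha⟩ := Set.mem_iUnion.1 ha
  obtain ⟨-, d, hd0, hd⟩ := hf
  obtain ⟨B, hB0, hB⟩ := O.isBounded.subset_closedBall_lt 0 0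
  -- The observable lives within radius `B` in space and time. Where the two cutoffs differ, |x₀| ≤
  -- d and ‖x⃗‖ ≥ 2B + d + 1, so spatial distances are at least B + d + 1 and time differences at
  -- most B + d.
  refine ⟨2 * B + d + 1, fun w hw hw0 => ?_⟩
  refine tendsto_nhds_unique (tendsto_const_nhds.congr' ?_) hc
  filter_upwards [eventually_ge_atTop (2 * B + d + 1)] with R hR
  have hR0 : 0 < R := by linarith
  rw [← sub_eq_zero, ← chargeComm_sub_left]
  refine j.local_observables 0 _ O (fun x hx y hy => ?_) a ha
  have hx' : x ∈ {x : Spacetime | |x.1| ≤ d ∧ 2 * B + d + 1 ≤ ‖x.2‖} := by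
    refine closure_minimal (fun x hx => ?_) ((isClosed_le
      (by fun_prop : Continuous fun x : Spacetime => |x.1|) continuous_const).inter
      (isClosed_le continuous_const (by fun_prop : Continuous fun x : Spacetime => ‖x.2‖))) hx
    have hx2 : w x - smear f g R x ≠ 0 := hx
    rw [smear_apply f g hR0] at hx2
    constructor
    · change |x.1| ≤ d
      by_contra! h
      have := hd x.1 h.le
      exact hx2 (by rw [hw0 x this, this, zero_mul, sub_zero])
    · change 2 * B + d + 1 ≤ ‖x.2‖
      by_contra! h
      refine hx2 ?_
      rw [hw x h.le, hg.1, mul_one, sub_self]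
      rw [norm_smul, norm_inv, Real.norm_of_nonneg hR0.le, inv_mul_le_iff₀ hR0]
      linarith
  have hyB : ‖y‖ ≤ B := by simpa using hB hy
  have hy1 : |y.1| ≤ B := (norm_fst_le y).trans hyB
  have hy2 : ‖y.2‖ ≤ B := (norm_snd_le y).trans hyB
  linarith [hx'.1, hx'.2, abs_sub x.1 y.1, norm_sub_norm_le x.2 y.2]

end ConservedCurrent

end Net

/-! ### Averages of observables and the fluctuation estimate -/

section Net

variable {A : Type*} [CStarAlgebra A]

/-- The points of a plane lattice in space. -/
def planePoint (p : ℕ × ℕ) : Space := !₂[(p.1 : ℝ), (p.2 : ℝ), 0]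

/-- The average of the translates of `a` over an `n × n` square. -/
def LocalNet.average (N : LocalNet A) (n : ℕ) (a : A) : A :=
  ((n : ℂ) ^ 2)⁻¹ • ∑ p ∈ Finset.range n ×ˢ Finset.range n, N.trans (0, planePoint p) a

theorem LocalNet.star_average (N : LocalNet A) (n : ℕ) (a : A) :
    star (N.average n a) = N.average n (star a) := by
  simp [average, star_smul, star_sum, map_star]

theorem norm_planePoint_le {n : ℕ} {p : ℕ × ℕ} (hp : p ∈ Finset.range n ×ˢ Finset.range n) :
    ‖planePoint p‖ ≤ 2 * n := by
  obtain ⟨h1, h2⟩ := Finset.mem_product.1 hp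
  have h1' : (p.1 : ℝ) ≤ n := by exact_mod_cast (Finset.mem_range.1 h1).le
  have h2' : (p.2 : ℝ) ≤ n := by exact_mod_cast (Finset.mem_range.1 h2).le
  refine norm_le_of_coord_le (Nat.cast_nonneg n) fun j => ?_
  fin_cases j <;> simp [planePoint, h1', h2']

theorem abs_natCast_sub_natCast (i j : ℕ) : |(i : ℝ) - j| = (Nat.dist i j : ℝ) := by
  rcases le_total i j with h | h
  · rw [Nat.dist_eq_sub_of_le h, Nat.cast_sub h, abs_sub_comm, abs_of_nonneg]
    exact sub_nonneg.2 (by exact_mod_cast h)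
  · rw [Nat.dist_eq_sub_of_le_right h, Nat.cast_sub h, abs_of_nonneg]
    exact sub_nonneg.2 (by exact_mod_cast h)

variable [PartialOrder A] [StarOrderedRing A]
variable {H : Type*} [NormedAddCommGroup H] [InnerProductSpace ℂ H] [CompleteSpace H]
variable {N : LocalNet A} {ω : A →ₚ[ℂ] ℂ}

theorem InvariantRep.state_star (r : InvariantRep N ω H) (a : A) :
    ω (star a) = (starRingEnd ℂ) (ω a) := by
  have h1 := r.inner_vec a 1
  have h2 := r.inner_vec 1 a
  rw [mul_one] at h1
  rw [star_one, one_mul] at h2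
  rw [← h1, ← h2, inner_conj_symm]

/-- The truncated correlations decay uniformly. -/
theorem ClustersWithRate.exists_le {δ : ℝ} (hδ : 0 < δ) (hcl : ClustersWithRate N ω δ)
    (r : InvariantRep N ω H) {a b : A} (ha : a ∈ N.strictlyLocal) (hb : b ∈ N.strictlyLocal) :
    ∃ K : ℝ, 0 ≤ K ∧ ∀ x : Space, ‖ω (a * N.trans (0, x) b) - ω a * ω b‖ ≤ K * (1 + ‖x‖) ^ (-δ) := by
  obtain ⟨C, hC⟩ := (hcl a ha b hb).bound
  obtain ⟨R, -, hR⟩ := (hasBasis_cobounded_norm (E := Space)).eventually_iff.1 hC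
  set M := ‖r.functional‖ * (‖a‖ * ‖b‖) + ‖ω a * ω b‖ with hM
  have hM0 : 0 ≤ M := by positivity
  set R' := max R 1
  have hR1 : 1 ≤ R' := le_max_right _ _
  refine ⟨max (|C| * 2 ^ δ) (M * (1 + R') ^ δ), by positivity, fun x => ?_⟩
  have hpos : 0 < 1 + ‖x‖ := by positivity
  -- Far out, ‖x‖ ≥ 1 makes ‖x‖ and 1 + ‖x‖ comparable up to a factor 2; nearby, the trivial bound
  -- `M` is enough.
  rcases le_total R' ‖x‖ with hx | hx
  · have h1 := hR (show R ≤ ‖x‖ from (le_max_left _ _).trans hx)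
    have hx1 : 1 ≤ ‖x‖ := hR1.trans hx
    have h2 : ‖x‖ ^ (-δ) ≤ 2 ^ δ * (1 + ‖x‖) ^ (-δ) := by
      have h3 : ((1 + ‖x‖) / 2) ^ (-δ) = 2 ^ δ * (1 + ‖x‖) ^ (-δ) := by
        rw [Real.div_rpow hpos.le zero_le_two, Real.rpow_neg zero_le_two, div_inv_eq_mul, mul_comm]
      rw [← h3]
      exact Real.rpow_le_rpow_of_nonpos (by positivity) (by linarith) (by linarith)
    calc ‖ω (a * N.trans (0, x) b) - ω a * ω b‖ ≤ C * ‖‖x‖ ^ (-δ)‖ := h1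
      _ ≤ |C| * (2 ^ δ * (1 + ‖x‖) ^ (-δ)) := by
          rw [Real.norm_of_nonneg (by positivity)]
          gcongr
          exact le_abs_self C
      _ = |C| * 2 ^ δ * (1 + ‖x‖) ^ (-δ) := by ring
      _ ≤ _ := by
          gcongr
          exact le_max_left _ _
  · have h1 : ‖ω (a * N.trans (0, x) b) - ω a * ω b‖ ≤ M := by
      refine (norm_sub_le _ _).trans ?_
      have := r.norm_functional_mul_le a (N.trans (0, x) b)
      rw [StarAlgEquiv.norm_map] at this
      linarith
    have h2 : 1 ≤ (1 + R') ^ δ * (1 + ‖x‖) ^ (-δ) := by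
      rw [Real.rpow_neg hpos.le, ← div_eq_mul_inv, one_le_div (by positivity)]
      exact Real.rpow_le_rpow hpos.le (by linarith) hδ.le
    calc ‖ω (a * N.trans (0, x) b) - ω a * ω b‖ ≤ M * ((1 + R') ^ δ * (1 + ‖x‖) ^ (-δ)) :=
          h1.trans (le_mul_of_one_le_right hM0 h2)
      _ = M * (1 + R') ^ δ * (1 + ‖x‖) ^ (-δ) := by ring
      _ ≤ _ := by
          gcongr
          exact le_max_right _ _

namespace InvariantRep

variable (r : InvariantRep N ω H)

theorem inner_fluctuation (a : A) (x y : Space) :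
    inner ℂ (r.T (0, x) (r.vec a) - ω a • r.Ω) (r.T (0, y) (r.vec a) - ω a • r.Ω)
      = ω (star a * N.trans (0, y - x) a) - ω (star a) * ω a := by
  have hΩ : inner ℂ r.Ω r.Ω = (1 : ℂ) := by
    have := r.inner_eq 1
    rw [map_one, one_apply_eq_self, r.normalized] at this
    exact this
  have h1 : inner ℂ (r.T (0, x) (r.vec a)) (r.T (0, y) (r.vec a))
      = ω (star a * N.trans (0, y - x) a) := by
    have : ((0 : ℝ), y) = (0, x) + (0, y - x) := by simp
    rw [this, r.T_add, LinearIsometryEquiv.inner_map_map, r.T_vec, r.inner_vec]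
  have h2 (z : Space) : inner ℂ r.Ω (r.T (0, z) (r.vec a)) = ω a := by
    rw [r.T_vec, r.vec_apply, r.inner_eq, r.invariant]
  have h3 (z : Space) : inner ℂ (r.T (0, z) (r.vec a)) r.Ω = ω (star a) := by
    rw [← inner_conj_symm, h2, r.state_star]
  rw [inner_sub_left, inner_sub_right, inner_sub_right, inner_smul_left, inner_smul_right,
    inner_smul_left, inner_smul_right, h1, h2, h3, hΩ, r.state_star]
  ring

/-- Fluctuations of averages over an `n × n` square are `o(1/n)` if the state clusters with a rate
larger than one. -/
theorem tendsto_fluctuation {δ : ℝ} (hδ : 1 < δ) (hcl : ClustersWithRate N ω δ) {a : A}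
    (ha : a ∈ N.strictlyLocal) (hsa : star a ∈ N.strictlyLocal) :
    Tendsto (fun n : ℕ => (n : ℝ) * ‖r.vec (N.average n a - ω a • 1)‖ ^ 2) atTop (𝓝 0) := by
  obtain ⟨K, hK0, hK⟩ := hcl.exists_le (by linarith) r hsa ha
  -- The split δ = p + q with p > 1 and q > 0 dominates the decay by a product over the two lattice
  -- directions: summable in one, vanishing at infinity in the other. It is available exactly
  -- because δ > 1.
  set p := (1 + δ) / 2 with hp
  set q := (δ - 1) / 2 with hq
  have hlim := (tendsto_square_average (p := p) (q := q) (by rw [hp]; linarith)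
    (by rw [hq]; linarith)).const_mul K
  rw [mul_zero] at hlim
  refine squeeze_zero' (Eventually.of_forall fun n => by positivity) ?_ hlim
  filter_upwards [eventually_gt_atTop 0] with n hn
  have hn' : (n : ℂ) ≠ 0 := by exact_mod_cast hn.ne'
  set s := Finset.range n ×ˢ Finset.range n with hs
  set ξ : ℕ × ℕ → H := fun p => r.T (0, planePoint p) (r.vec a) - ω a • r.Ω with hξ
  have hcard : s.card = n ^ 2 := by
    rw [hs, Finset.card_product, Finset.card_range, sq]
  have hvec : r.vec (N.average n a - ω a • 1) = ((n : ℂ) ^ 2)⁻¹ • ∑ p ∈ s, ξ p := by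
    simp only [hξ]
    rw [Finset.sum_sub_distrib, Finset.sum_const, hcard, map_sub, LocalNet.average, map_smul,
      map_sum, map_smul, r.vec_one, smul_sub, ← Nat.cast_smul_eq_nsmul ℂ,
      smul_smul (((n : ℂ) ^ 2)⁻¹)]
    push_cast
    rw [inv_mul_cancel₀ (pow_ne_zero 2 hn'), one_smul]
    simp only [r.T_vec]
    rfl
  have hpair (u v : ℕ × ℕ) : ‖inner ℂ (ξ u) (ξ v)‖
      ≤ K * ((1 + (Nat.dist u.1 v.1 : ℝ)) ^ (-p) * (1 + (Nat.dist u.2 v.2 : ℝ)) ^ (-q)) := by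
    rw [hξ]
    dsimp only
    rw [r.inner_fluctuation]
    refine (hK _).trans (mul_le_mul_of_nonneg_left ?_ hK0)
    set x := planePoint v - planePoint u with hx
    have h0 : (Nat.dist u.1 v.1 : ℝ) ≤ ‖x‖ := by
      refine le_trans (le_of_eq ?_) (coord_le_norm x 0)
      rw [Nat.dist_comm, ← abs_natCast_sub_natCast]
      simp [hx, planePoint]
    have h1 : (Nat.dist u.2 v.2 : ℝ) ≤ ‖x‖ := by
      refine le_trans (le_of_eq ?_) (coord_le_norm x 1)
      rw [Nat.dist_comm, ← abs_natCast_sub_natCast]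
      simp [hx, planePoint]
    have hsplit : -δ = -p + -q := by
      rw [hp, hq]
      ring
    rw [hsplit, Real.rpow_add (by positivity)]
    refine mul_le_mul ?_ ?_ (by positivity) (by positivity)
    · exact Real.rpow_le_rpow_of_nonpos (by positivity) (by linarith) (by rw [hp]; linarith)
    · exact Real.rpow_le_rpow_of_nonpos (by positivity) (by linarith) (by rw [hq]; linarith)
  have hsum : ‖∑ p ∈ s, ξ p‖ ^ 2 ≤ K *
      ((∑ i ∈ Finset.range n, ∑ i' ∈ Finset.range n, (1 + (Nat.dist i i' : ℝ)) ^ (-p)) *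
        ∑ j ∈ Finset.range n, ∑ j' ∈ Finset.range n, (1 + (Nat.dist j j' : ℝ)) ^ (-q)) := by
    have h1 : ‖∑ p ∈ s, ξ p‖ ^ 2 = ‖inner ℂ (∑ p ∈ s, ξ p) (∑ p ∈ s, ξ p)‖ := by
      rw [inner_self_eq_norm_sq_to_K]
      simp
    rw [h1, sum_inner]
    simp only [inner_sum]
    refine (norm_sum_le_of_le _ fun u _ => norm_sum_le_of_le _ fun v _ => hpair u v).trans_eq ?_
    simp only [← Finset.mul_sum]
    congr 1
    rw [hs, Finset.sum_product, Finset.sum_mul]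
    refine Finset.sum_congr rfl fun i _ => ?_
    rw [Finset.sum_comm, Finset.sum_product, Finset.sum_mul]
    refine Finset.sum_congr rfl fun i' _ => ?_
    rw [Finset.sum_comm, Finset.mul_sum]
    refine Finset.sum_congr rfl fun j _ => ?_
    rw [Finset.mul_sum]
  rw [hvec, norm_smul, mul_pow, norm_inv, norm_pow, Complex.norm_natCast, ← inv_pow, ← inv_pow, ← pow_mul]
  calc (n : ℝ) * ((n : ℝ)⁻¹ ^ (2 * 2) * ‖∑ p ∈ s, ξ p‖ ^ 2)
      ≤ n * ((n : ℝ)⁻¹ ^ (2 * 2) * (K *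
      ((∑ i ∈ Finset.range n, ∑ i' ∈ Finset.range n, (1 + (Nat.dist i i' : ℝ)) ^ (-p)) *
        ∑ j ∈ Finset.range n, ∑ j' ∈ Finset.range n, (1 + (Nat.dist j j' : ℝ)) ^ (-q)))) := by
        gcongr
    _ = _ := by
        rw [inv_pow]
        ring

end InvariantRep

/-! ### Absence of spontaneous symmetry breaking -/

/-- If a KMS state clusters with a rate larger than one, the commutator of a conserved charge with
a strictly local observable has vanishing expectation value. -/
theorem ConservedCurrent.limit_chargeComm_eq_zero {β : ℝ} (r : ThermalRep N ω β H)
    (j : ConservedCurrent r.toInvariantRep) {δ : ℝ} (hδ : 1 < δ) (hcl : ClustersWithRate N ω δ)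
    {a : A} (ha : a ∈ N.strictlyLocal) {f : 𝓓((⊤ : Opens ℝ), ℝ)} (hf : IsTimeCutoff f)
    {g : 𝓓((⊤ : Opens Space), ℝ)} (hg : IsSpaceCutoff g) {c : ℂ}
    (hc : Tendsto (fun R => j.chargeComm (smear f g R) a) atTop (𝓝 c)) : c = 0 := by
  have hsa : star a ∈ N.strictlyLocal := by
    obtain ⟨O, hO⟩ := Set.mem_iUnion.1 ha
    exact Set.mem_iUnion.2 ⟨O, star_mem hO⟩
  obtain ⟨ρ, hρ⟩ := j.exists_chargeComm_eq ha hf hg hc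
  obtain ⟨C, hC⟩ := j.exists_commutator_le hf
  have hflu := (r.toInvariantRep.tendsto_fluctuation hδ hcl ha hsa).add
    (r.toInvariantRep.tendsto_fluctuation hδ hcl hsa (by rwa [star_star]))
  rw [add_zero] at hflu
  have hcomm : ∀ᶠ n : ℕ in atTop,
      j.chargeComm (latticeSmear f n) (N.average n a - ω a • 1) = c := by
    filter_upwards [eventually_gt_atTop 0, eventually_ge_atTop ⌈ρ⌉₊] with n hn hnρ
    have hn' : (n : ℂ) ≠ 0 := by exact_mod_cast hn.ne'
    have hρn : ρ ≤ n := (Nat.le_ceil ρ).trans (by exact_mod_cast hnρ)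
    change j.chargeCommLM (latticeSmear f n) (N.average n a - ω a • 1) = c
    rw [map_sub, map_smul, LocalNet.average, map_smul, map_sum]
    change _ - ω a • j.chargeComm (latticeSmear f n) 1 = c
    rw [j.chargeComm_one, smul_zero, sub_zero, Finset.sum_congr rfl (g := fun _ => c)]
    · rw [Finset.sum_const, Finset.card_product, Finset.card_range, ← Nat.cast_smul_eq_nsmul ℂ,
        smul_smul]
      push_cast
      rw [← sq, inv_mul_cancel₀ (pow_ne_zero 2 hn'), one_smul]
    -- Translating the observable amounts to translating the cutoff back, by at most 2n; its plateau
    -- of radius 3n still covers radius n ≥ ρ.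
    · intro p hp
      change j.chargeComm (latticeSmear f n) _ = c
      rw [j.chargeComm_trans]
      refine hρ _ (fun x hx => ?_) (fun x hx => ?_)
      · rw [translate_apply, latticeSmear_eq hn]
        · simp
        · have h1 : (x - -((0 : ℝ), planePoint p)).2 = x.2 + planePoint p := by simp
          rw [h1]
          refine (norm_add_le _ _).trans ?_
          linarith [norm_planePoint_le hp]
      · rw [translate_apply, latticeSmear_eq_zero]
        simpa using hx
  have hbound (m : ℝ) (hm : 0 < m) : 2 * ‖c‖ ≤ m * C := by
    have hlim : Tendsto (fun n : ℕ => m * C + m⁻¹ * β *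
        ((n : ℝ) * ‖r.vec (N.average n a - ω a • 1)‖ ^ 2
          + (n : ℝ) * ‖r.vec (N.average n (star a) - ω (star a) • 1)‖ ^ 2)) atTop (𝓝 (m * C)) := by
      simpa using (hflu.const_mul (m⁻¹ * β)).const_add (m * C)
    refine ge_of_tendsto hlim ?_
    filter_upwards [hcomm, hC, eventually_gt_atTop 0] with n h1 h2 hn
    have hn' : (0 : ℝ) < n := by exact_mod_cast hn
    -- The choice l = m/n cancels the linear growth of the double commutator and multiplies the
    -- fluctuations by n/m, which their o(1/n) decay absorbs.
    have hb := r.bogoliubov (j.vec_mem_selfAdjointVectors (latticeSmear f n))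
      (j.hasDerivAt_T_vec (latticeSmear f n)) (N.average n a - ω a • 1)
      (l := m / n) (by positivity)
    rw [← j.chargeComm_eq, h1] at hb
    have hstar : star (N.average n a - ω a • 1) = N.average n (star a) - ω (star a) • 1 := by
      rw [star_sub, N.star_average, star_smul, star_one, r.toInvariantRep.state_star,
        starRingEnd_apply]
    rw [hstar] at hb
    refine hb.trans ?_
    refine add_le_add ?_ (le_of_eq ?_)
    · refine (mul_le_mul_of_nonneg_left h2 (by positivity)).trans_eq ?_
      field_simp
    · field_simp
  have hzero : Tendsto (fun m : ℝ => m * C) (𝓝[>] 0) (𝓝 0) := by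
    have : Tendsto (fun m : ℝ => m * C) (𝓝 0) (𝓝 (0 * C)) := Continuous.tendsto (by fun_prop) 0
    simpa using this.mono_left nhdsWithin_le_nhds
  have h := ge_of_tendsto hzero (eventually_of_mem self_mem_nhdsWithin fun m hm => hbound m hm)
  exact norm_le_zero_iff.1 (by linarith)

end Net

end ThermalQFT

end

theorem corollary1 {A : Type*} [CStarAlgebra A] [PartialOrder A] [StarOrderedRing A]
    (N : ThermalQFT.LocalNet A)
    {H₀ : Type*} [NormedAddCommGroup H₀] [InnerProductSpace ℂ H₀] [CompleteSpace H₀]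
    (ω₀ : A →ₚ[ℂ] ℂ) (v : ThermalQFT.VacuumRep N ω₀ H₀)
    {H : Type*} [NormedAddCommGroup H] [InnerProductSpace ℂ H] [CompleteSpace H]
    (ω : A →ₚ[ℂ] ℂ) (β : ℝ) (r : ThermalQFT.ThermalRep N ω β H)
    (j : ThermalQFT.ConservedCurrent r.toInvariantRep) (γ : ThermalQFT.InternalSymmetry j)
    (conj : ThermalQFT.MassDecayConjecture v ω)
    (ssb : γ.SpontaneouslyBroken) :
    v.HasParticlesOfMass 0 := by
  by_contra hmass
  -- An occurring mass is nonnegative by definition, so excluding 0 makes it positive.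
  have hmassive : v.Massive := fun m hm =>
    lt_of_le_of_ne hm.1 fun h => hmass (h ▸ hm)
  obtain ⟨δ, hδ, hcl⟩ := conj.2 hmassive
  obtain ⟨a, ha, f, g, hf, hg, c, hc0, hc⟩ := ssb
  exact hc0 (ThermalQFT.ConservedCurrent.limit_chargeComm_eq_zero r j hδ hcl ha hf hg hc)
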